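/- **Setting.** Fix a field $\mathbb F$ and $l\in\mathbb N$. A persistence module $V$ is a functor from the ordered set $\{0,1,\dots,l\}$ to $\mathbb F$-vector spaces with every $V_i$ finite dimensional; put $V_i=0$ for integers $i\notin\{0,\dots,l\}$, and $V(s)_t=V_{t+s}$ for $s\in\mathbb N$. For an interval $J=[a,b]\subseteq\{0,\dots,l\}$ with $a\le b$, $k_J$ is the interval module, and the length of $J$ is $b-a$. $V$ is isomorphic to a finite direct sum of interval modules, and $\mathrm{Barc}(V)$ is the multiset of the intervals that occur. The *nestedness* $\Xi(V)\in(0,\infty]$ is the minimum of $\min\{|a-c|,|b-d|\}$ over all strictly nested pairs of bars $[a,b],[c,d]\in\mathrm{Barc}(V)$, $c<a\le b<d$ (and $\infty$ if there are none). A morphism $\Phi\colon V\to W$ is *$\delta$-invertible* if $2\delta$ is a non-negative integer and there is a morphism $\Psi\colon W\to V(2\delta)$ such that $\Psi_t\circ\Phi_t=v_{t,t+2\delta}$ and $\Phi_{t+2\delta}\circ\Psi_t=w_{t,t+2\delta}$ for all $t$. For real $q\ge 0$, a *$q$-splitting* of $V$ is an isomorphism $V\cong V_{\ge q}\oplus V_{<q}$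 where all bars of $V_{\ge q}$ have length $\ge q$ and all bars of $V_{<q}$ have length $<q$. Denote by $pr^V_{\ge q}\colon V\to V_{\ge q}$, $i^V_{\ge q}\colon V_{\ge q}\to V$ and $i^V_{<q}\colon V_{<q}\to V$ the induced projection and inclusions. A *barcode basis* of $V$ is a family of ordered bases $B_i$ of $V_i$ such that each matrix $A$ of $V_{i}\to V_{i+1}$ in these bases is in barcode form: there is a strictly increasing $c\colon\{1,\dots,\operatorname{rank}A\}\to\{1,\dots,\dim V_i\}$ with $A_{xy}=1$ if $x\le\operatorname{rank}A$ and $y=c(x)$, and $A_{xy}=0$ otherwise. Write $[i_1,j_1]\preceq[i_2,j_2]$ if $i_1\le i_2\le j_1\le j_2$. The elementary ladder modules are $\mathbf R_K^J=(k_J\to k_K)$ for $K\preceq J$ (the identity of $\mathbb F$ on $J\cap K$), $\mathbf I^+_J=(k_J\to 0)$ and $\mathbf I^-_K=(0\to k_K)$. A morphism $\Phi\colon V\to W$ *decomposes as a ladder persistence module in barcode bases $\mathcal B_V,\mathcal B_W$* if $(V,W,\Phi)$ is isomorphic to a finite direct sum of elementary ladder modules, by an isomorphism taking $\mathcal B_V$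 and $\mathcal B_W$ (as sets at each index) to the standard bases of that sum. **Theorem.** Let $\Phi\colon V\to W$ be a $\delta$-invertible morphism of persistence modules, and let $q\ge 0$ be real. 1. For every $q$-splitting of $W$: if $\delta<\frac12\min(\Xi(V),\Xi(W_{\ge q}))-\frac q2$, then $pr^W_{\ge q}\circ\Phi\colon V\to W_{\ge q}$ is $(\delta+\frac{\lceil q\rceil}2)$-invertible and decomposes as a ladder persistence module in some barcode bases of $V$ and $W_{\ge q}$. 2. For every $q$-splitting of $V$: if $\delta<\frac12\min(\Xi(V_{\ge q}),\Xi(W))-\frac q2$, then $\Phi\circ i^V_{\ge q}\colon V_{\ge q}\to W$ is $(\delta+\frac{\lceil q\rceil}2)$-invertible and decomposes as a ladder persistence module in some barcode bases of $V_{\ge q}$ and $W$. 3. For all $q$-splittings of $V$ and of $W$: if $\delta<\frac12\min(\Xi(V_{\ge q}),\Xi(W_{\ge q}))-\frac q2$, then $pr^W_{\ge q}\circ\Phi\circ i^V_{\ge q}\colon V_{\ge q}\to W_{\ge q}$ is $(\delta+\frac{\lceil q\rceil}2)$-invertible and decomposes as a ladder persistence module in some barcode bases of $V_{\ge q}$ and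 $W_{\ge q}$. (For integer $q$ the invertibility parameter is $\delta+\frac q2$.) Furthermore, in each case the bases can be chosen so that those of the truncated modules extend to barcode bases of the full modules: the basis of $V_{\ge q}$ (respectively $W_{\ge q}$) together with some barcode basis of $V_{<q}$ (respectively $W_{<q}$), mapped by the inclusions into $V$ (respectively $W$) and suitably ordered, is a barcode basis of $V$ (respectively $W$). -/

import Mathlib

open CategoryTheory CategoryTheory.Limits
open scoped ZeroObject

noncomputable section

namespace Ladder

universe u

/-- Persistence modules over the field `F` indexed by `[l+1] = {0, …, l}`: functors from this
totally ordered set to vector spaces. (Pointwise finite dimensionality is a separate hypothesis.) -/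
abbrev PersMod (F : Type u) [Field F] (l : ℕ) := Fin (l + 1) ⥤ ModuleCat.{u} F

instance (F : Type u) [Field F] (l : ℕ) : HasFiniteBiproducts (PersMod F l) :=
  HasFiniteBiproducts.of_hasFiniteProducts

/-- A nonempty closed interval `[birth, death]` in `{0, …, l}`. -/
@[ext] structure Bar (l : ℕ) where
  birth : Fin (l + 1)
  death : Fin (l + 1)
  le : birth ≤ death

namespace Bar

variable {l : ℕ}

/-- `i ∈ [birth, death]`. -/
def Has (J : Bar l) (i : Fin (l + 1)) : Prop := J.birth ≤ i ∧ i ≤ J.death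

instance (J : Bar l) (i : Fin (l + 1)) : Decidable (J.Has i) :=
  inferInstanceAs (Decidable (_ ∧ _))

/-- The length `b - a` of the bar `[a, b]`. -/
def length (J : Bar l) : ℝ := ((J.death : ℕ) : ℝ) - ((J.birth : ℕ) : ℝ)

/-- The overlapping relation `[i₁, j₁] ⪯ [i₂, j₂]`, i.e. `i₁ ≤ i₂ ≤ j₁ ≤ j₂`. -/
def Precedes (K J : Bar l) : Prop :=
  K.birth ≤ J.birth ∧ J.birth ≤ K.death ∧ K.death ≤ J.death

/-- `J` is strictly nested in `K`: `[i₁, j₁] ⊂ [i₂, j₂]`, i.e. `i₂ < i₁ ≤ j₁ < j₂`. -/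
def StrictlyNested (J K : Bar l) : Prop := K.birth < J.birth ∧ J.death < K.death

end Bar

section Interval

variable (F : Type u) [Field F] {l : ℕ}

/-- The vector space of the interval module `k_J` at the index `i`:
`F` if `i ∈ J`, and `0` otherwise. -/
abbrev intervalSpace (J : Bar l) (i : Fin (l + 1)) : Submodule F F := if J.Has i then ⊤ else ⊥

/-- The map `k_J(i) → k_K(j)` that is the identity of `F` if `i ∈ J` and `j ∈ K`, and zero
otherwise. -/
def transfer (J K : Bar l) (i j : Fin (l + 1)) : intervalSpace F J i →ₗ[F] intervalSpace F K j where
  toFun x := ⟨if K.Has j then (x : F) else 0, by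
    by_cases h : K.Has j <;> simp [intervalSpace, h]⟩
  map_add' x y := by ext; by_cases h : K.Has j <;> simp [h]
  map_smul' a x := by ext; by_cases h : K.Has j <;> simp [h]

theorem intervalSpace_eq_zero {J : Bar l} {i : Fin (l + 1)} (h : ¬ J.Has i)
    (x : intervalSpace F J i) : (x : F) = 0 := by
  have := x.2
  simpa [intervalSpace, h] using this

@[simp] theorem coe_transfer (J K : Bar l) (i j : Fin (l + 1)) (x : intervalSpace F J i) :
    (transfer F J K i j x : F) = if K.Has j then (x : F) else 0 := rfl

/-- The interval persistence module `k_J`. -/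
def intervalModule (J : Bar l) : PersMod F l where
  obj i := ModuleCat.of F (intervalSpace F J i)
  map {i j} _ := ModuleCat.ofHom (transfer F J J i j)
  map_id i := by
    ext (x : intervalSpace F J i)
    change (if J.Has i then (x : F) else 0) = x
    split_ifs with h
    · rfl
    · exact (intervalSpace_eq_zero F h x).symm
  map_comp {i j k} f g := by
    ext (x : intervalSpace F J i)
    change (if J.Has k then (x : F) else 0) = if J.Has k then (if J.Has j then (x : F) else 0) else 0
    have hij := leOfHom f
    have hjk := leOfHom g
    split_ifs with h1 h2
    · rfl
    · refine intervalSpace_eq_zero F (fun h => h2 ⟨h.1.trans hij, hjk.trans h1.2⟩) x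
    · rfl

/-- For `K ⪯ J`, the morphism `k_J ⟶ k_K` that is the identity of `F` on `J ∩ K` and zero
elsewhere. -/
def overlapMap (K J : Bar l) (h : K.Precedes J) : intervalModule F J ⟶ intervalModule F K where
  app i := ModuleCat.ofHom (transfer F J K i i)
  naturality i j f := by
    ext (x : intervalSpace F J i)
    apply Subtype.ext
    change (if K.Has j then (if J.Has j then (x : F) else 0) else 0)
      = if K.Has j then (if K.Has i then (x : F) else 0) else 0
    have hij := leOfHom f
    by_cases hK : K.Has j
    · by_cases hJ : J.Has i
      · have h1 : J.Has j := ⟨hJ.1.trans hij, hK.2.trans h.2.2⟩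
        have h2 : K.Has i := ⟨h.1.trans hJ.1, hij.trans hK.2⟩
        simp [h1, h2]
      · simp [intervalSpace_eq_zero F hJ x]
    · simp [hK]

/-- The generator `1 ∈ F = k_J(i)` if `i ∈ J`; empty if `i ∉ J`. -/
def intervalBasis (J : Bar l) (i : Fin (l + 1)) : Set ((intervalModule F J).obj i) :=
  ({x | J.Has i ∧ (x : F) = 1} : Set (intervalSpace F J i))

end Interval

section Barcode

variable {F : Type u} [Field F] {l : ℕ}

/-- The set of bars of `V` (the underlying set of the barcode): the intervals `K` for which `k_K`
appears in an interval decomposition of `V`. -/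
def bars (V : PersMod F l) : Set (Bar l) :=
  {K | ∃ (n : ℕ) (J : Fin n → Bar l),
    Nonempty (V ≅ ⨁ fun k => intervalModule F (J k)) ∧ ∃ k, J k = K}

/-- The nestedness `Ξ(V)`: the least distance between the births or between the deaths of two
strictly nested bars of `V`, and `∞` if there are no strictly nested bars. -/
def nestedness (V : PersMod F l) : EReal :=
  ⨅ (J ∈ bars V) (K ∈ bars V) (_ : J.StrictlyNested K),
    ((min |((J.birth : ℕ) : ℝ) - ((K.birth : ℕ) : ℝ)|
          |((J.death : ℕ) : ℝ) - ((K.death : ℕ) : ℝ)| : ℝ) : EReal)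

end Barcode

section Invertible

variable {F : Type u} [Field F] {l : ℕ}

/-- A morphism `W ⟶ V(s)` into the shift `V(s)_t = V_{t+s}`. Persistence modules are zero at
indices outside `{0, …, l}`, so such a morphism consists of maps `W_t ⟶ V_{t+s}` for those `t`
with `t + s ≤ l`, compatible with the inner morphisms. -/
structure ShiftHom (W V : PersMod F l) (s : ℕ) where
  app : ∀ t u : Fin (l + 1), (u : ℕ) = t + s → (W.obj t ⟶ V.obj u)
  naturality : ∀ (t t' u u' : Fin (l + 1)) (hu : (u : ℕ) = t + s) (hu' : (u' : ℕ) = t' + s)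
    (f : t ⟶ t') (g : u ⟶ u'), W.map f ≫ app t' u' hu' = app t u hu ≫ V.map g

/-- `Φ : V ⟶ W` is `δ`-invertible: there is `Ψ : W ⟶ V(2δ)` such that both compositions of `Φ`
and `Ψ` are the inner morphisms of `V` and `W` over `2δ` steps. The shift by `2δ` makes sense only
if `2δ` is a nonnegative integer. -/
def IsInvertible {V W : PersMod F l} (Φ : V ⟶ W) (δ : ℝ) : Prop :=
  ∃ s : ℕ, (s : ℝ) = 2 * δ ∧ ∃ Ψ : ShiftHom W V s,
    (∀ (t u : Fin (l + 1)) (hu : (u : ℕ) = t + s) (f : t ⟶ u),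
      Φ.app t ≫ Ψ.app t u hu = V.map f) ∧
    (∀ (t u : Fin (l + 1)) (hu : (u : ℕ) = t + s) (f : t ⟶ u),
      Ψ.app t u hu ≫ Φ.app u = W.map f)

end Invertible

section BarcodeBasis

variable {F : Type u} [Field F] {l : ℕ}

/-- An `m × n` matrix `A` of rank `r` is in barcode form if there is a strictly increasing
`c : {1, …, r} → {1, …, n}` such that `A i j = 1` if `j = c i`, and `A i j = 0` otherwise. -/
def IsBarcodeForm {m n : ℕ} (A : Matrix (Fin m) (Fin n) F) : Prop :=
  ∃ c : Fin A.rank → Fin n, StrictMono c ∧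
    (∀ (i : Fin m) (j : Fin n), (∃ h : (i : ℕ) < A.rank, j = c ⟨i, h⟩) → A i j = 1) ∧
    (∀ (i : Fin m) (j : Fin n), (¬ ∃ h : (i : ℕ) < A.rank, j = c ⟨i, h⟩) → A i j = 0)

/-- A barcode basis of `V`: ordered bases of all the spaces `V_i` such that all the matrices of the
inner morphisms `V_i ⟶ V_{i+1}` are in barcode form. -/
structure BarcodeBasis (V : PersMod F l) where
  basis : ∀ i : Fin (l + 1), Module.Basis (Fin (Module.finrank F (V.obj i))) F (V.obj i)
  barcodeForm : ∀ i : Fin l, IsBarcodeForm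
    (LinearMap.toMatrix (basis i.castSucc) (basis i.succ)
      (V.map (homOfLE (Fin.castSucc_lt_succ (i := i)).le)).hom)

end BarcodeBasis

section Decomposition

variable {F : Type u} [Field F] {l : ℕ}

/-- Labels of the elementary ladder persistence modules `R_K^J` (for `K ⪯ J`), `I⁺_J`, `I⁻_K`. -/
inductive Elementary (l : ℕ) where
  | R (K J : Bar l) (h : K.Precedes J)
  | plus (J : Bar l)
  | minus (K : Bar l)

variable (F) in
/-- The elementary ladder persistence modules, as morphisms of persistence modules:
`R_K^J` is `k_J ⟶ k_K`, `I⁺_J` is `k_J ⟶ 0` and `I⁻_K` is `0 ⟶ k_K`. -/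
def Elementary.arrow : Elementary l → Arrow (PersMod F l)
  | .R K J h => Arrow.mk (overlapMap F K J h)
  | .plus J => Arrow.mk (0 : intervalModule F J ⟶ 0)
  | .minus K => Arrow.mk (0 : 0 ⟶ intervalModule F K)

variable (F) in
/-- The standard basis at the index `i` of the domain of an elementary ladder module. -/
def Elementary.sourceBasis (i : Fin (l + 1)) : (E : Elementary l) → Set ((E.arrow F).left.obj i)
  | .R _ J _ => intervalBasis F J i
  | .plus J => intervalBasis F J i
  | .minus _ => ∅

variable (F) in
/-- The standard basis at the index `i` of the codomain of an elementary ladder module. -/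
def Elementary.targetBasis (i : Fin (l + 1)) : (E : Elementary l) → Set ((E.arrow F).right.obj i)
  | .R K _ _ => intervalBasis F K i
  | .plus _ => ∅
  | .minus K => intervalBasis F K i

/-- `Φ` decomposes as a ladder persistence module in the barcode bases `B` of `V` and `C` of `W`:
the ladder persistence module `(V, W, Φ)` is isomorphic to a finite direct sum of elementary ones,
by an isomorphism that carries `B` and `C` to the standard bases of the direct sum. -/
def DecomposesIn {V W : PersMod F l} (Φ : V ⟶ W) (B : BarcodeBasis V) (C : BarcodeBasis W) : Prop :=
  ∃ (n : ℕ) (E : Fin n → Elementary l)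
    (e : Arrow.mk Φ ≅ Arrow.mk (biproduct.map fun k => ((E k).arrow F).hom)),
    (∀ i, (fun x => e.hom.left.app i x) '' Set.range (B.basis i) =
      ⋃ k, (fun x => (biproduct.ι (fun k => ((E k).arrow F).left) k).app i x) ''
        (E k).sourceBasis F i) ∧
    (∀ i, (fun x => e.hom.right.app i x) '' Set.range (C.basis i) =
      ⋃ k, (fun x => (biproduct.ι (fun k => ((E k).arrow F).right) k).app i x) ''
        (E k).targetBasis F i)

end Decomposition

section Splitting

variable {F : Type u} [Field F] {l : ℕ}

/-- A `q`-splitting `V ≅ V_{≥q} ⊕ V_{<q}`. -/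
structure QSplitting (V : PersMod F l) (q : ℝ) where
  coarse : PersMod F l
  fine : PersMod F l
  iso : V ≅ coarse ⊞ fine
  le_length : ∀ J ∈ bars coarse, q ≤ J.length
  length_lt : ∀ J ∈ bars fine, J.length < q

namespace QSplitting

variable {V : PersMod F l} {q : ℝ} (S : QSplitting V q)

/-- The projection `pr_{≥q} : V ⟶ V_{≥q}`. -/
def pr : V ⟶ S.coarse := S.iso.hom ≫ biprod.fst

/-- The inclusion `i_{≥q} : V_{≥q} ⟶ V`. -/
def incl : S.coarse ⟶ V := biprod.inl ≫ S.iso.inv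

/-- The inclusion `i_{<q} : V_{<q} ⟶ V`. -/
def inclFine : S.fine ⟶ V := biprod.inr ≫ S.iso.inv

/-- The barcode basis `B` of `V_{≥q}` can be extended to a barcode basis of `V`: for some barcode
basis `B'` of `V_{<q}`, the union of the images of `B` and `B'` in `V` is, suitably ordered, a
barcode basis of `V`. -/
def Extends (B : BarcodeBasis S.coarse) : Prop :=
  ∃ (B' : BarcodeBasis S.fine) (D : BarcodeBasis V), ∀ i,
    Set.range (D.basis i) =
      (fun x => S.incl.app i x) '' Set.range (B.basis i) ∪
        (fun x => S.inclFine.app i x) '' Set.range (B'.basis i)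

end QSplitting

end Splitting

end Ladder

end

noncomputable section

namespace Ladder

universe u

section IntervalModules

variable {F : Type u} [Field F] {l : ℕ}

/-- The generator of `k_J` at the index `i` (zero if `i ∉ J`). -/
def intervalGen (F : Type u) [Field F] (J : Bar l) (i : Fin (l + 1)) : (intervalModule F J).obj i :=
  (⟨if J.Has i then 1 else 0, by by_cases h : J.Has i <;> simp [intervalSpace, h]⟩ :
    intervalSpace F J i)

/-- The coordinate of an element of `k_J(i) ⊆ F`. -/
def intervalCoord (J : Bar l) (i : Fin (l + 1)) : (intervalModule F J).obj i →ₗ[F] F :=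
  (intervalSpace F J i).subtype

theorem intervalCoord_injective (J : Bar l) (i : Fin (l + 1)) :
    Function.Injective (intervalCoord (F := F) J i) :=
  Subtype.val_injective

theorem intervalCoord_gen (J : Bar l) (i : Fin (l + 1)) :
    intervalCoord J i (intervalGen F J i) = if J.Has i then 1 else 0 := rfl

theorem intervalCoord_of_not_has {J : Bar l} {i : Fin (l + 1)} (h : ¬ J.Has i)
    (x : (intervalModule F J).obj i) : intervalCoord J i x = 0 :=
  intervalSpace_eq_zero F h x

theorem has_of_intervalCoord_ne_zero {J : Bar l} {i : Fin (l + 1)}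
    {x : (intervalModule F J).obj i} (h : intervalCoord J i x ≠ 0) : J.Has i :=
  not_not.1 fun h' => h (intervalCoord_of_not_has h' x)

theorem intervalGen_of_not_has {J : Bar l} {i : Fin (l + 1)} (h : ¬ J.Has i) :
    intervalGen F J i = 0 := by
  apply intervalCoord_injective
  rw [intervalCoord_gen, if_neg h, map_zero]

theorem eq_smul_intervalGen (J : Bar l) (i : Fin (l + 1)) (x : (intervalModule F J).obj i) :
    x = intervalCoord J i x • intervalGen F J i := by
  apply intervalCoord_injective
  rw [map_smul, intervalCoord_gen]
  split_ifs with h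
  · simp
  · simp [intervalCoord_of_not_has h]

theorem intervalCoord_map (J : Bar l) {i j : Fin (l + 1)} (f : i ⟶ j)
    (x : (intervalModule F J).obj i) :
    intervalCoord J j ((intervalModule F J).map f x) =
      if J.Has j then intervalCoord J i x else 0 := rfl

theorem map_intervalGen (J : Bar l) {i j : Fin (l + 1)} (f : i ⟶ j) (h : J.Has i) :
    (intervalModule F J).map f (intervalGen F J i) = intervalGen F J j := by
  apply intervalCoord_injective
  rw [intervalCoord_map, intervalCoord_gen, intervalCoord_gen, if_pos h]

theorem Bar.has_birth (J : Bar l) : J.Has J.birth := ⟨le_rfl, J.le⟩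

theorem Bar.has_death (J : Bar l) : J.Has J.death := ⟨J.le, le_rfl⟩

theorem Bar.Precedes.refl (J : Bar l) : J.Precedes J := ⟨le_rfl, J.le, le_rfl⟩

theorem Bar.Precedes.has_birth {K J : Bar l} (h : K.Precedes J) : K.Has J.birth := ⟨h.1, h.2.1⟩

theorem app_map_apply {V W : PersMod F l} (Φ : V ⟶ W) {i j : Fin (l + 1)} (f : i ⟶ j)
    (x : V.obj i) : Φ.app j (V.map f x) = W.map f (Φ.app i x) :=
  NatTrans.naturality_apply Φ f x

theorem app_comp_apply {U V W : PersMod F l} (Φ : U ⟶ V) (Ψ : V ⟶ W) (i : Fin (l + 1))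
    (x : U.obj i) : (Φ ≫ Ψ).app i x = Ψ.app i (Φ.app i x) := rfl

theorem app_add_apply {V W : PersMod F l} (Φ Ψ : V ⟶ W) (i : Fin (l + 1))
    (x : V.obj i) : (Φ + Ψ).app i x = Φ.app i x + Ψ.app i x := rfl

theorem app_smul_apply {V W : PersMod F l} (c : F) (Φ : V ⟶ W) (i : Fin (l + 1))
    (x : V.obj i) : (c • Φ).app i x = c • Φ.app i x := rfl

theorem app_zero_apply {V W : PersMod F l} (i : Fin (l + 1))
    (x : V.obj i) : (0 : V ⟶ W).app i x = 0 := rfl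

theorem app_sum_apply {V W : PersMod F l} {κ : Type*} (s : Finset κ) (Φ : κ → (V ⟶ W))
    (i : Fin (l + 1)) (x : V.obj i) :
    (∑ k ∈ s, Φ k).app i x = ∑ k ∈ s, (Φ k).app i x := by
  classical
  induction s using Finset.induction_on with
  | empty => rfl
  | insert a s ha ih => rw [Finset.sum_insert ha, Finset.sum_insert ha, app_add_apply, ih]

theorem map_map_apply (V : PersMod F l) {i j k : Fin (l + 1)} (f : i ⟶ j) (g : j ⟶ k) (h : i ⟶ k)
    (x : V.obj i) : V.map g (V.map f x) = V.map h x := by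
  rw [Subsingleton.elim h (f ≫ g), V.map_comp]; rfl

theorem map_self_apply (V : PersMod F l) {i : Fin (l + 1)} (f : i ⟶ i) (x : V.obj i) :
    V.map f x = x := by
  rw [Subsingleton.elim f (𝟙 i), V.map_id]; rfl

theorem hom_ext_apply {V W : PersMod F l} {Φ Ψ : V ⟶ W}
    (h : ∀ i (x : V.obj i), Φ.app i x = Ψ.app i x) : Φ = Ψ := by
  ext i x
  exact h i x

/-- A morphism out of `k_J` is determined by the image of the generator at the birth of `J`. -/
theorem intervalModule_hom_ext {V : PersMod F l} {J : Bar l} {f g : intervalModule F J ⟶ V}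
    (h : f.app J.birth (intervalGen F J J.birth) = g.app J.birth (intervalGen F J J.birth)) :
    f = g := by
  refine hom_ext_apply fun i x => ?_
  rw [eq_smul_intervalGen J i x, map_smul, map_smul]
  congr 1
  by_cases hi : J.Has i
  · rw [← map_intervalGen J (homOfLE hi.1) J.has_birth, app_map_apply, app_map_apply, h]
  · rw [intervalGen_of_not_has hi, map_zero, map_zero]

/-- A morphism into `k_K` is determined by its component at the death of `K`. -/
theorem hom_intervalModule_ext {V : PersMod F l} {K : Bar l} {f g : V ⟶ intervalModule F K}
    (h : ∀ x, intervalCoord K K.death (f.app K.death x) =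
      intervalCoord K K.death (g.app K.death x)) : f = g := by
  refine hom_ext_apply fun i x => intervalCoord_injective K i ?_
  by_cases hi : K.Has i
  · have := h (V.map (homOfLE hi.2) x)
    rwa [app_map_apply, app_map_apply, intervalCoord_map, intervalCoord_map, if_pos K.has_death,
      if_pos K.has_death] at this
  · rw [intervalCoord_of_not_has hi, intervalCoord_of_not_has hi]

open Classical in
/-- The canonical morphism `k_J ⟶ k_K` if `K ⪯ J`, and zero otherwise. -/
def overlap (F : Type u) [Field F] (K J : Bar l) : intervalModule F J ⟶ intervalModule F K :=
  if h : K.Precedes J then overlapMap F K J h else 0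

theorem overlap_of_precedes {K J : Bar l} (h : K.Precedes J) :
    overlap F K J = overlapMap F K J h := dif_pos h

theorem intervalCoord_overlap {K J : Bar l} (h : K.Precedes J) (i : Fin (l + 1))
    (x : (intervalModule F J).obj i) :
    intervalCoord K i ((overlap F K J).app i x) = if K.Has i then intervalCoord J i x else 0 := by
  rw [overlap_of_precedes h]; rfl

theorem overlap_gen {K J : Bar l} (h : K.Precedes J) :
    (overlap F K J).app J.birth (intervalGen F J J.birth) = intervalGen F K J.birth := by
  apply intervalCoord_injective
  rw [intervalCoord_overlap h, intervalCoord_gen, intervalCoord_gen, if_pos J.has_birth]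

theorem overlap_ne_zero {K J : Bar l} (h : K.Precedes J) : overlap F K J ≠ 0 := by
  intro h0
  have h1 := congrArg (fun f : intervalModule F J ⟶ intervalModule F K =>
    intervalCoord K J.birth (f.app J.birth (intervalGen F J J.birth))) h0
  simp only [overlap_gen h, intervalCoord_gen, if_pos h.has_birth, app_zero_apply, map_zero] at h1
  exact one_ne_zero h1

theorem overlap_self (J : Bar l) : overlap F J J = 𝟙 _ := by
  apply intervalModule_hom_ext
  rw [overlap_gen (.refl J)]; rfl

theorem overlap_comp {K J I : Bar l} (h1 : K.Precedes J) (h2 : J.Precedes I)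
    (h3 : K.Precedes I) : overlap F J I ≫ overlap F K J = overlap F K I := by
  refine hom_ext_apply fun i x => intervalCoord_injective K i ?_
  rw [app_comp_apply, intervalCoord_overlap h1, intervalCoord_overlap h2, intervalCoord_overlap h3]
  split_ifs with hK hJ
  · rfl
  · refine (intervalCoord_of_not_has (fun hI => hJ ⟨h2.1.trans hI.1, hK.2.trans h1.2.2⟩) x).symm
  · rfl

/-- The scalar by which a morphism `k_J ⟶ k_K` acts. -/
def homScalar {K J : Bar l} (f : intervalModule F J ⟶ intervalModule F K) : F :=
  intervalCoord K J.birth (f.app J.birth (intervalGen F J J.birth))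

theorem precedes_of_homScalar_ne_zero {K J : Bar l} {f : intervalModule F J ⟶ intervalModule F K}
    (h : homScalar f ≠ 0) : K.Precedes J := by
  have h1 := has_of_intervalCoord_ne_zero h
  refine ⟨h1.1, h1.2, ?_⟩
  by_contra! h2
  apply h
  have h3 : ¬ J.Has K.death := fun h' => absurd h'.2 (not_le.2 h2)
  have h4 := app_map_apply f (homOfLE h1.2) (intervalGen F J J.birth)
  rw [map_intervalGen J _ J.has_birth, intervalGen_of_not_has h3, map_zero] at h4
  have h5 := congrArg (intervalCoord K K.death) h4
  rw [intervalCoord_map, if_pos K.has_death, map_zero] at h5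
  exact h5.symm

theorem eq_homScalar_smul_overlap {K J : Bar l} (f : intervalModule F J ⟶ intervalModule F K) :
    f = homScalar f • overlap F K J := by
  apply intervalModule_hom_ext
  apply intervalCoord_injective
  rw [app_smul_apply, map_smul]
  by_cases h : K.Precedes J
  · rw [overlap_gen h, intervalCoord_gen, if_pos h.has_birth]
    simp [homScalar]
  · have : homScalar f = 0 := not_not.1 fun h' => h (precedes_of_homScalar_ne_zero h')
    rw [this, zero_smul]
    exact this

end IntervalModules

/-- The maps `i k : X k ⟶ V` and `p k : V ⟶ X k` exhibit `V` as the direct sum of the `X k`. -/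
structure IsSplitting {C : Type*} [Category* C] [Preadditive C] {κ : Type*} [Fintype κ] {V : C}
    {X : κ → C} (i : ∀ k, X k ⟶ V) (p : ∀ k, V ⟶ X k) : Prop where
  self : ∀ k, i k ≫ p k = 𝟙 (X k)
  ne : ∀ j k, j ≠ k → i j ≫ p k = 0
  total : ∑ k, p k ≫ i k = 𝟙 V

theorem IsSplitting.sum_apply {F : Type u} [Field F] {l : ℕ} {V : PersMod F l} {κ : Type*}
    [Fintype κ] {X : κ → PersMod F l} {i : ∀ k, X k ⟶ V} {p : ∀ k, V ⟶ X k}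
    (h : IsSplitting i p) (t : Fin (l + 1)) (x : V.obj t) :
    ∑ k, (i k).app t ((p k).app t x) = x := by
  have := app_sum_apply Finset.univ (fun k => p k ≫ i k) t x
  rw [h.total] at this
  exact this.symm

/-- The endpoints of `J` and `K` differ by more than `s` and by at least `s + m`, with `J` inside
`K`. -/
structure Bar.Far {l : ℕ} (s m : ℕ) (J K : Bar l) : Prop where
  birth_lt : (K.birth : ℕ) + s < J.birth
  birth_le : (K.birth : ℕ) + s + m ≤ J.birth
  lt_death : (J.death : ℕ) + s < K.death
  le_death : (J.death : ℕ) + s + m ≤ K.death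

/-- `Ψ : W ⟶ V(s)` is inverse to `Φ` after a further shift by `m`. -/
structure AlmostInverse {F : Type u} [Field F] {l : ℕ} {V W : PersMod F l} (Φ : V ⟶ W) {s : ℕ}
    (Ψ : ShiftHom W V s) (m : ℕ) : Prop where
  left : ∀ (t u u' : Fin (l + 1)) (hu : (u : ℕ) = t + s) (_ : (u' : ℕ) = u + m)
    (f : u ⟶ u') (g : t ⟶ u') (x : V.obj t),
    V.map f (Ψ.app t u hu (Φ.app t x)) = V.map g x
  right : ∀ (t u u' : Fin (l + 1)) (hu : (u : ℕ) = t + s) (_ : (u' : ℕ) = u + m)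
    (f : u ⟶ u') (g : t ⟶ u') (x : W.obj t),
    W.map f (Φ.app u (Ψ.app t u hu x)) = W.map g x

section Reduction

variable {F : Type u} [Field F] {l : ℕ}

theorem ShiftHom.naturality_apply {V W : PersMod F l} {s : ℕ} (Ψ : ShiftHom W V s)
    {t t' u u' : Fin (l + 1)} (hu : (u : ℕ) = t + s) (hu' : (u' : ℕ) = t' + s)
    (f : t ⟶ t') (g : u ⟶ u') (x : W.obj t) :
    Ψ.app t' u' hu' (W.map f x) = V.map g (Ψ.app t u hu x) :=
  congrArg (fun h : W.obj t ⟶ V.obj u' => h x) (Ψ.naturality t t' u u' hu hu' f g)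

/-- If `K` contains a bar which is far inside, the morphism `k_J ⟶ k_K ⟶ W` lifts
through `Φ`, by a morphism which has no components at the bars succeeding `J`. -/
theorem exists_lift_overlap {V W : PersMod F l} {Φ : V ⟶ W} {s m : ℕ} {Ψ : ShiftHom W V s}
    (hΨ : AlmostInverse Φ Ψ m) {κ : Type*} [Fintype κ] {J : κ → Bar l}
    {i : ∀ k, intervalModule F (J k) ⟶ V} {p : ∀ k, V ⟶ intervalModule F (J k)}
    (hV : IsSplitting i p) {I K : Bar l} (ι : intervalModule F K ⟶ W) (hKI : K.Precedes I)
    (h1 : (K.birth : ℕ) + s < I.birth) (h2 : (K.birth : ℕ) + s + m ≤ I.birth)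
    (hI : ∀ k, I.StrictlyNested (J k) → I.Far s m (J k)) :
    ∃ θ : intervalModule F I ⟶ V, θ ≫ Φ = overlap F K I ≫ ι ∧
      ∀ k, I.Precedes (J k) → θ ≫ p k = 0 := by
  classical
  have hIl := I.birth.isLt
  let u : Fin (l + 1) := ⟨K.birth + s, by omega⟩
  let u' : Fin (l + 1) := ⟨K.birth + s + m, by omega⟩
  have huI : u ≤ I.birth := by change (K.birth : ℕ) + s ≤ I.birth; omega
  have huu' : u ≤ u' := by change (K.birth : ℕ) + s ≤ K.birth + s + m; omega
  have hu'I : u' ≤ I.birth := h2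
  have hKu' : K.birth ≤ u' := by change (K.birth : ℕ) ≤ K.birth + s + m; omega
  let v : V.obj u := Ψ.app K.birth u rfl (ι.app _ (intervalGen F K K.birth))
  let y : κ → F := fun k => intervalCoord (J k) u ((p k).app u v)
  have hyu : ∀ k, y k ≠ 0 → (J k).Has u := fun k hk => has_of_intervalCoord_ne_zero hk
  have hyb : ∀ k, y k ≠ 0 → (J k).birth < I.birth := fun k hk =>
    (hyu k hk).1.trans_lt h1
  have hyd : ∀ k, y k ≠ 0 → ((J k).death : ℕ) ≤ K.death + s := by
    intro k hk
    by_contra! hlt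
    have hud := (hyu k hk).2
    have hud' : (K.birth : ℕ) + s ≤ (J k).death := hud
    have hdl := (J k).death.isLt
    let t : Fin (l + 1) := ⟨(J k).death - s, by omega⟩
    have ht : K.birth ≤ t := by change (K.birth : ℕ) ≤ (J k).death - s; omega
    have hKt : ¬ K.Has t := fun h => by
      have : ((J k).death : ℕ) - s ≤ K.death := h.2
      omega
    have h3 := Ψ.naturality_apply (u := u) (u' := (J k).death) rfl
      (show ((J k).death : ℕ) = ((J k).death - s : ℕ) + s by omega) (homOfLE ht) (homOfLE hud)
      (ι.app _ (intervalGen F K K.birth))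
    rw [← app_map_apply, map_intervalGen _ _ K.has_birth, intervalGen_of_not_has hKt, map_zero,
      map_zero] at h3
    have h4 := congrArg (fun x => intervalCoord (J k) _ ((p k).app _ x)) h3
    simp only [map_zero] at h4
    rw [app_map_apply, intervalCoord_map, if_pos (J k).has_death] at h4
    exact hk h4.symm
  have hyp : ∀ k, y k ≠ 0 → (J k).Has I.birth → (J k).Precedes I := by
    intro k hk hh
    refine ⟨(hyb k hk).le, hh.2, ?_⟩
    by_contra! hlt
    have h3 := (hI k ⟨hyb k hk, hlt⟩).lt_death
    have h4 := hyd k hk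
    have h5 : (K.death : ℕ) ≤ I.death := hKI.2.2
    omega
  refine ⟨∑ k, y k • (overlap F (J k) I ≫ i k), ?_, ?_⟩
  · apply intervalModule_hom_ext
    have hv : (∑ k, y k • (overlap F (J k) I ≫ i k)).app I.birth (intervalGen F I I.birth) =
        V.map (homOfLE huI) v := by
      rw [app_sum_apply, ← hV.sum_apply I.birth (V.map (homOfLE huI) v)]
      refine Finset.sum_congr rfl fun k _ => ?_
      rw [app_smul_apply, app_comp_apply, ← map_smul]
      congr 1
      apply intervalCoord_injective
      rw [app_map_apply, intervalCoord_map, map_smul, smul_eq_mul]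
      change y k * _ = if (J k).Has I.birth then y k else 0
      by_cases hk : y k = 0
      · simp [hk]
      · split_ifs with hh
        · rw [overlap_gen (hyp k hk hh), intervalCoord_gen, if_pos hh, mul_one]
        · rw [intervalCoord_of_not_has hh, mul_zero]
    rw [app_comp_apply, hv, app_comp_apply, overlap_gen hKI, app_map_apply,
      ← map_map_apply W (homOfLE huu') (homOfLE hu'I),
      hΨ.right K.birth u u' rfl rfl _ (homOfLE hKu'), ← app_map_apply, ← app_map_apply,
      map_intervalGen _ _ K.has_birth, map_intervalGen]
    exact ⟨hKu', hu'I.trans hKI.2.1⟩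
  · intro k hk
    rw [Preadditive.sum_comp]
    refine Finset.sum_eq_zero fun k' _ => ?_
    by_cases hy : y k' = 0
    · rw [hy, zero_smul, zero_comp]
    rw [Linear.smul_comp, Category.assoc]
    by_cases hkk : k' = k
    · subst hkk
      exact absurd hk.1 (not_le.2 (hyb _ hy))
    · rw [hV.ne _ _ hkk, comp_zero, smul_zero]

/-- If `I` contains a bar which is far inside and dies after `K`, the morphism
`V ⟶ k_I ⟶ k_K` extends along `Φ`. -/
theorem exists_extension_overlap {V W : PersMod F l} {Φ : V ⟶ W} {s m : ℕ} {Ψ : ShiftHom W V s}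
    (hΨ : AlmostInverse Φ Ψ m) {κ : Type*} [Fintype κ] {J : κ → Bar l}
    {i : ∀ k, intervalModule F (J k) ⟶ W} {p : ∀ k, W ⟶ intervalModule F (J k)}
    (hW : IsSplitting i p) {I K : Bar l} (π : V ⟶ intervalModule F I) (hKI : K.Precedes I)
    (h1 : (K.death : ℕ) + s < I.death) (h2 : (K.death : ℕ) + s + m ≤ I.death)
    (hK : ∀ k, K.StrictlyNested (J k) → K.Far s m (J k)) :
    ∃ θ : W ⟶ intervalModule F K, Φ ≫ θ = π ≫ overlap F K I := by
  classical
  have hIl := I.death.isLt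
  let t : Fin (l + 1) := ⟨I.death - s, by omega⟩
  let t' : Fin (l + 1) := ⟨I.death - s - m, by omega⟩
  let u' : Fin (l + 1) := ⟨I.death - m, by omega⟩
  have ht : (I.death : ℕ) = t + s := by change (I.death : ℕ) = (I.death - s : ℕ) + s; omega
  have hKt : K.death ≤ t := by change (K.death : ℕ) ≤ I.death - s; omega
  have hKt' : K.death ≤ t' := by change (K.death : ℕ) ≤ I.death - s - m; omega
  have ht't : t' ≤ t := by change (I.death - s - m : ℕ) ≤ I.death - s; omega
  have hu' : (u' : ℕ) = t' + s := by change (I.death - m : ℕ) = (I.death - s - m : ℕ) + s; omega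
  have hu'm : (I.death : ℕ) = u' + m := by change (I.death : ℕ) = (I.death - m : ℕ) + m; omega
  have hu'I : u' ≤ I.death := by change (I.death - m : ℕ) ≤ I.death; omega
  have ht'I : t' ≤ I.death := by change (I.death - s - m : ℕ) ≤ I.death; omega
  have hKd : K.death ≤ I.death := hKI.2.2
  let z : κ → F := fun k => intervalCoord I I.death
    (π.app _ (Ψ.app t I.death ht ((i k).app t (intervalGen F (J k) t))))
  have hzt : ∀ k, z k ≠ 0 → (J k).Has t := by
    intro k hk
    by_contra hh
    apply hk
    change intervalCoord I I.death
      (π.app _ (Ψ.app t I.death ht ((i k).app t (intervalGen F (J k) t)))) = 0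
    rw [intervalGen_of_not_has hh]
    simp only [map_zero]
  have hzb : ∀ k, z k ≠ 0 → (I.birth : ℕ) ≤ (J k).birth + s := by
    intro k hk
    by_contra! hlt
    have hbt : (J k).birth ≤ t := (hzt k hk).1
    have hbt' : ((J k).birth : ℕ) ≤ I.death - s := hbt
    let u : Fin (l + 1) := ⟨(J k).birth + s, by omega⟩
    have hu : u ≤ I.death := by change ((J k).birth : ℕ) + s ≤ I.death; omega
    have h3 := Ψ.naturality_apply (u := u) rfl ht (homOfLE hbt) (homOfLE hu)
      ((i k).app _ (intervalGen F (J k) (J k).birth))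
    rw [← app_map_apply, map_intervalGen _ _ (J k).has_birth] at h3
    apply hk
    change intervalCoord I I.death
      (π.app _ (Ψ.app t I.death ht ((i k).app t (intervalGen F (J k) t)))) = 0
    rw [h3, app_map_apply, intervalCoord_map, if_pos I.has_death]
    refine intervalCoord_of_not_has (fun hh => ?_) _
    have : (I.birth : ℕ) ≤ (J k).birth + s := hh.1
    omega
  have hzp : ∀ k, z k ≠ 0 → (J k).Has K.death → K.Precedes (J k) := by
    intro k hk hh
    refine ⟨?_, hh.1, hh.2⟩
    by_contra! hlt
    have h3 : (I.death - s : ℕ) ≤ (J k).death := (hzt k hk).2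
    have h4 := (hK k ⟨hlt, show (K.death : ℕ) < (J k).death by omega⟩).birth_lt
    have h5 := hzb k hk
    have h6 : (K.birth : ℕ) ≤ I.birth := hKI.1
    omega
  refine ⟨∑ k, z k • (p k ≫ overlap F K (J k)), ?_⟩
  refine hom_intervalModule_ext fun x => ?_
  rw [app_comp_apply, app_comp_apply, intervalCoord_overlap hKI, if_pos K.has_death]
  have h3 : intervalCoord I K.death (π.app _ x) =
      intervalCoord I I.death (π.app _ (V.map (homOfLE hKd) x)) := by
    rw [app_map_apply, intervalCoord_map, if_pos I.has_death]
  rw [h3, ← map_map_apply V (homOfLE hKt') (homOfLE ht'I),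
    ← hΨ.left t' u' I.death hu' hu'm (homOfLE hu'I),
    ← Ψ.naturality_apply hu' ht (homOfLE ht't), app_map_apply, map_map_apply W _ _ (homOfLE hKt)]
  conv_rhs => rw [← hW.sum_apply K.death (Φ.app K.death x)]
  rw [app_sum_apply]
  simp only [map_sum]
  refine Finset.sum_congr rfl fun k _ => ?_
  generalize Φ.app K.death x = w
  rw [app_smul_apply, app_comp_apply, ← app_map_apply,
    eq_smul_intervalGen (J k) t ((intervalModule F (J k)).map _ _), intervalCoord_map]
  simp only [map_smul, smul_eq_mul]
  change z k * _ = _ * z k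
  by_cases hk : z k = 0
  · rw [hk, zero_mul, mul_zero]
  rw [if_pos (hzt k hk), mul_comm]
  congr 1
  by_cases hh : (J k).Has K.death
  · rw [intervalCoord_overlap (hzp k hk hh), if_pos K.has_death]
  · rw [intervalCoord_of_not_has hh, eq_smul_intervalGen (J k) K.death ((p k).app _ w),
      intervalGen_of_not_has hh, smul_zero, map_zero, map_zero]

end Reduction

section Pivot

variable {F : Type u} [Field F] {l : ℕ}

/-- A nonzero, almost invertible morphism between direct sums of intervals whose strictly nested
bars are far apart has an elementary ladder module `k_J ⟶ k_K` as a direct summand. -/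
theorem exists_elementary_summand {V W : PersMod F l} {Φ : V ⟶ W} {s m : ℕ} {Ψ : ShiftHom W V s}
    (hΨ : AlmostInverse Φ Ψ m) {κ κ' : Type*} [Fintype κ] [Fintype κ'] {I : κ → Bar l}
    {i : ∀ k, intervalModule F (I k) ⟶ V} {p : ∀ k, V ⟶ intervalModule F (I k)}
    (hV : IsSplitting i p) {I' : κ' → Bar l}
    {i' : ∀ k, intervalModule F (I' k) ⟶ W} {p' : ∀ k, W ⟶ intervalModule F (I' k)}
    (hW : IsSplitting i' p')
    (hI : ∀ j k, (I j).StrictlyNested (I k) → (I j).Far s m (I k))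
    (hI' : ∀ j k, (I' j).StrictlyNested (I' k) → (I' j).Far s m (I' k)) (hΦ : Φ ≠ 0) :
    ∃ (J K : Bar l) (h : K.Precedes J) (iJ : intervalModule F J ⟶ V)
      (pJ : V ⟶ intervalModule F J) (iK : intervalModule F K ⟶ W) (pK : W ⟶ intervalModule F K),
      iJ ≫ pJ = 𝟙 _ ∧ iK ≫ pK = 𝟙 _ ∧ iJ ≫ Φ = overlapMap F K J h ≫ iK ∧
        Φ ≫ pK = pJ ≫ overlapMap F K J h := by
  classical
  let φ : κ' → κ → F := fun k j => homScalar (i j ≫ Φ ≫ p' k)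
  have hφ : ∀ k j, i j ≫ Φ ≫ p' k = φ k j • overlap F (I' k) (I j) := fun k j =>
    eq_homScalar_smul_overlap _
  have hpre : ∀ k j, φ k j ≠ 0 → (I' k).Precedes (I j) := fun k j h =>
    precedes_of_homScalar_ne_zero h
  have hcol : ∀ j, i j ≫ Φ = ∑ k, φ k j • (overlap F (I' k) (I j) ≫ i' k) := fun j => by
    rw [← Category.comp_id (i j ≫ Φ), ← hW.total, Preadditive.comp_sum]
    refine Finset.sum_congr rfl fun k _ => ?_
    rw [← Linear.smul_comp, ← hφ]; simp only [Category.assoc]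
  have hrow : ∀ k, Φ ≫ p' k = ∑ j, φ k j • (p j ≫ overlap F (I' k) (I j)) := fun k => by
    rw [← Category.id_comp (Φ ≫ p' k), ← hV.total, Preadditive.sum_comp]
    refine Finset.sum_congr rfl fun j _ => ?_
    rw [← Linear.comp_smul, ← hφ]; simp only [Category.assoc]
  have hne : ∃ k j, φ k j ≠ 0 := by
    by_contra! h
    apply hΦ
    rw [← Category.id_comp Φ, ← hV.total, Preadditive.sum_comp]
    refine Finset.sum_eq_zero fun j _ => ?_
    rw [Category.assoc, hcol j]
    simp [h]
  obtain ⟨k₁, j₁, hk₁⟩ := hne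
  obtain ⟨k₀, hk₀, hmax⟩ := Finset.exists_max_image
    (Finset.univ.filter fun k => ∃ j, φ k j ≠ 0)
    (fun k => toLex ((I' k).birth, (I' k).death)) ⟨k₁, by simpa using ⟨j₁, hk₁⟩⟩
  obtain ⟨j₂, hj₂⟩ := (Finset.mem_filter.1 hk₀).2
  obtain ⟨j₀, hj₀, hmin⟩ := Finset.exists_min_image
    (Finset.univ.filter fun j => φ k₀ j ≠ 0)
    (fun j => toLex ((I j).death, (I j).birth)) ⟨j₂, by simpa using hj₂⟩
  have hφ₀ : φ k₀ j₀ ≠ 0 := (Finset.mem_filter.1 hj₀).2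
  have hKJ := hpre _ _ hφ₀
  have hcolpre : ∀ k, φ k j₀ ≠ 0 → ¬ (I' k₀).StrictlyNested (I' k) →
      (I' k).Precedes (I' k₀) := by
    intro k hk hn
    have h1 := hmax k (by simpa using ⟨j₀, hk⟩)
    have h2 := hpre k j₀ hk
    rw [Prod.Lex.toLex_le_toLex] at h1
    simp only [Bar.StrictlyNested, not_and, not_lt] at hn
    rcases h1 with h1 | ⟨h1, h3⟩
    · exact ⟨h1.le, hKJ.1.trans h2.2.1, hn h1⟩
    · exact ⟨h1.le, hKJ.1.trans h2.2.1, h3⟩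
  have hrowpre : ∀ j, φ k₀ j ≠ 0 → ¬ (I j₀).StrictlyNested (I j) →
      (I j₀).Precedes (I j) := by
    intro j hj hn
    have h1 := hmin j (by simpa using hj)
    have h2 := hpre k₀ j hj
    rw [Prod.Lex.toLex_le_toLex] at h1
    simp only [Bar.StrictlyNested, not_and, not_lt] at hn
    rcases h1 with h1 | ⟨h1, h3⟩
    · exact ⟨not_lt.1 fun h => absurd h1 (not_lt.2 (hn h)), h2.2.1.trans hKJ.2.2, h1.le⟩
    · exact ⟨h3, h2.2.1.trans hKJ.2.2, h1.le⟩
  have hlift : ∀ k, ∃ θ : intervalModule F (I j₀) ⟶ V, (φ k j₀ ≠ 0 →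
      (I' k₀).StrictlyNested (I' k) → θ ≫ Φ = overlap F (I' k) (I j₀) ≫ i' k) ∧
      ∀ j, (I j₀).Precedes (I j) → θ ≫ p j = 0 := by
    intro k
    by_cases hk : φ k j₀ ≠ 0 ∧ (I' k₀).StrictlyNested (I' k)
    · have hfar := hI' _ _ hk.2
      have hb : ((I' k₀).birth : ℕ) ≤ (I j₀).birth := hKJ.1
      obtain ⟨θ, h1, h2⟩ := exists_lift_overlap hΨ hV (i' k) (hpre k j₀ hk.1)
        (hfar.birth_lt.trans_le hb) (hfar.birth_le.trans hb) (hI j₀)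
      exact ⟨θ, fun _ _ => h1, h2⟩
    · exact ⟨0, fun h1 h2 => absurd ⟨h1, h2⟩ hk, fun _ _ => zero_comp⟩
  have hext : ∀ j, ∃ θ : W ⟶ intervalModule F (I' k₀), φ k₀ j ≠ 0 →
      (I j₀).StrictlyNested (I j) → Φ ≫ θ = p j ≫ overlap F (I' k₀) (I j) := by
    intro j
    by_cases hj : φ k₀ j ≠ 0 ∧ (I j₀).StrictlyNested (I j)
    · have hfar := hI _ _ hj.2
      have hd : ((I' k₀).death : ℕ) ≤ (I j₀).death := hKJ.2.2
      obtain ⟨θ, h1⟩ := exists_extension_overlap hΨ hW (p j) (hpre k₀ j hj.1)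
        (lt_of_le_of_lt (by omega) hfar.lt_death) (le_trans (by omega) hfar.le_death) (hI' k₀)
      exact ⟨θ, fun _ _ => h1⟩
    · exact ⟨0, fun h1 h2 => absurd ⟨h1, h2⟩ hj⟩
  choose θ hθ hθp using hlift
  choose η hη using hext
  let A := Finset.univ.filter fun k => (I' k₀).StrictlyNested (I' k)
  let A' := Finset.univ.filter fun k => ¬ (I' k₀).StrictlyNested (I' k)
  let B := Finset.univ.filter fun j => (I j₀).StrictlyNested (I j)
  let B' := Finset.univ.filter fun j => ¬ (I j₀).StrictlyNested (I j)
  let iJ : intervalModule F (I j₀) ⟶ V := i j₀ - ∑ k ∈ A, φ k j₀ • θ k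
  let iK : intervalModule F (I' k₀) ⟶ W :=
    ∑ k ∈ A', φ k j₀ • (overlap F (I' k) (I' k₀) ≫ i' k)
  let pK : W ⟶ intervalModule F (I' k₀) := p' k₀ - ∑ j ∈ B, φ k₀ j • η j
  let pJ : V ⟶ intervalModule F (I j₀) := ∑ j ∈ B', φ k₀ j • (p j ≫ overlap F (I j₀) (I j))
  have hi : iJ ≫ Φ = overlap F (I' k₀) (I j₀) ≫ iK := by
    have h1 : (∑ k ∈ A, φ k j₀ • θ k) ≫ Φ =
        ∑ k ∈ A, φ k j₀ • (overlap F (I' k) (I j₀) ≫ i' k) := by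
      rw [Preadditive.sum_comp]
      refine Finset.sum_congr rfl fun k hk => ?_
      by_cases h0 : φ k j₀ = 0
      · simp [h0]
      · rw [Linear.smul_comp, hθ k h0 (Finset.mem_filter.1 hk).2]
    rw [Preadditive.sub_comp, h1, hcol, Preadditive.comp_sum, sub_eq_iff_eq_add',
      ← Finset.sum_filter_add_sum_filter_not Finset.univ
        (fun k => (I' k₀).StrictlyNested (I' k))]
    congr 1
    refine Finset.sum_congr rfl fun k hk => ?_
    by_cases h0 : φ k j₀ = 0
    · simp [h0]
    · rw [Linear.comp_smul, ← Category.assoc,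
        overlap_comp (hcolpre k h0 (Finset.mem_filter.1 hk).2) hKJ (hpre k j₀ h0)]
  have hp : Φ ≫ pK = pJ ≫ overlap F (I' k₀) (I j₀) := by
    have h1 : Φ ≫ (∑ j ∈ B, φ k₀ j • η j) =
        ∑ j ∈ B, φ k₀ j • (p j ≫ overlap F (I' k₀) (I j)) := by
      rw [Preadditive.comp_sum]
      refine Finset.sum_congr rfl fun j hj => ?_
      by_cases h0 : φ k₀ j = 0
      · simp [h0]
      · rw [Linear.comp_smul, hη j h0 (Finset.mem_filter.1 hj).2]
    rw [Preadditive.comp_sub, h1, hrow, Preadditive.sum_comp, sub_eq_iff_eq_add',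
      ← Finset.sum_filter_add_sum_filter_not Finset.univ
        (fun j => (I j₀).StrictlyNested (I j))]
    congr 1
    refine Finset.sum_congr rfl fun j hj => ?_
    by_cases h0 : φ k₀ j = 0
    · simp [h0]
    · rw [Linear.smul_comp, Category.assoc,
        overlap_comp hKJ (hrowpre j h0 (Finset.mem_filter.1 hj).2) (hpre k₀ j h0)]
  have hself : iJ ≫ pJ = φ k₀ j₀ • 𝟙 _ := by
    have hz : ∀ k, θ k ≫ pJ = 0 := by
      intro k
      rw [Preadditive.comp_sum]
      refine Finset.sum_eq_zero fun j hj => ?_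
      by_cases h0 : φ k₀ j = 0
      · simp [h0]
      · rw [Linear.comp_smul, ← Category.assoc,
          hθp k j (hrowpre j h0 (Finset.mem_filter.1 hj).2), zero_comp, smul_zero]
    have hz' : (∑ k ∈ A, φ k j₀ • θ k) ≫ pJ = 0 := by
      rw [Preadditive.sum_comp]
      exact Finset.sum_eq_zero fun k _ => by rw [Linear.smul_comp, hz, smul_zero]
    rw [Preadditive.sub_comp, hz', sub_zero, Preadditive.comp_sum, Finset.sum_eq_single j₀]
    · rw [Linear.comp_smul, ← Category.assoc, hV.self, Category.id_comp, overlap_self]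
    · intro j _ hj
      rw [Linear.comp_smul, ← Category.assoc, hV.ne _ _ hj.symm, zero_comp, smul_zero]
    · intro h
      exact absurd (Finset.mem_filter.2 ⟨Finset.mem_univ _, fun h => lt_irrefl _ h.1⟩) h
  have hself' : iK ≫ pK = φ k₀ j₀ • 𝟙 _ := by
    have h1 : overlap F (I' k₀) (I j₀) ≫ iK ≫ pK = φ k₀ j₀ • overlap F (I' k₀) (I j₀) := by
      rw [← Category.assoc, ← hi, Category.assoc, hp, ← Category.assoc, hself, Linear.smul_comp,
        Category.id_comp]
    have h2 := eq_homScalar_smul_overlap (iK ≫ pK)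
    rw [overlap_self] at h2
    rw [h2, Linear.comp_smul, Category.comp_id] at h1
    rw [h2, smul_left_injective F (overlap_ne_zero hKJ) h1]
  rw [overlap_of_precedes hKJ] at hi hp
  refine ⟨I j₀, I' k₀, hKJ, (φ k₀ j₀)⁻¹ • iJ, pJ, (φ k₀ j₀)⁻¹ • iK, pK, ?_, ?_, ?_, hp⟩
  · rw [Linear.smul_comp, hself, inv_smul_smul₀ hφ₀]
  · rw [Linear.smul_comp, hself', inv_smul_smul₀ hφ₀]
  · rw [Linear.smul_comp, hi, Linear.comp_smul]

end Pivot

section Complement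

/-- In an additive category with kernels, a retract has a complement. -/
theorem exists_complement {C : Type*} [Category* C] [Preadditive C] [HasKernels C] {V X : C}
    {i : X ⟶ V} {p : V ⟶ X} (h : i ≫ p = 𝟙 X) :
    ∃ (V' : C) (i' : V' ⟶ V) (p' : V ⟶ V'), i' ≫ p' = 𝟙 V' ∧ i ≫ p' = 0 ∧ i' ≫ p = 0 ∧
      p' ≫ i' = 𝟙 V - p ≫ i := by
  have h1 : (𝟙 V - p ≫ i) ≫ p = 0 := by
    rw [Preadditive.sub_comp, Category.id_comp, Category.assoc, h, Category.comp_id, sub_self]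
  refine ⟨kernel p, kernel.ι p, kernel.lift p _ h1, ?_, ?_, kernel.condition p,
    kernel.lift_ι p _ h1⟩
  · rw [← cancel_mono (kernel.ι p), Category.assoc, kernel.lift_ι, Preadditive.comp_sub,
      ← Category.assoc (kernel.ι p) p, kernel.condition]
    simp
  · rw [← cancel_mono (kernel.ι p), Category.assoc, kernel.lift_ι, Preadditive.comp_sub,
      ← Category.assoc i p, h]
    simp

end Complement

section Splittings

variable {C : Type*} [Category* C] [Preadditive C]

/-- A splitting of the complement of a retract extends to a splitting of the whole object. -/
theorem IsSplitting.cons {T : Type*} (G : T → C) {V V' : C} {e₀ : T} {i₀ : G e₀ ⟶ V}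
    {p₀ : V ⟶ G e₀} {i' : V' ⟶ V} {p' : V ⟶ V'} (h₀ : i₀ ≫ p₀ = 𝟙 _) (h₁ : i' ≫ p' = 𝟙 _)
    (h₂ : i₀ ≫ p' = 0) (h₃ : i' ≫ p₀ = 0) (h₄ : p' ≫ i' = 𝟙 V - p₀ ≫ i₀) {n : ℕ}
    {e : Fin n → T} {i : ∀ k, G (e k) ⟶ V'} {p : ∀ k, V' ⟶ G (e k)} (h : IsSplitting i p) :
    IsSplitting (X := fun k => G (Fin.cons (α := fun _ => T) e₀ e k))
      (fun k => Fin.cases (motive := fun k => G (Fin.cons (α := fun _ => T) e₀ e k) ⟶ V)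
        i₀ (fun k => i k ≫ i') k)
      (fun k => Fin.cases (motive := fun k => V ⟶ G (Fin.cons (α := fun _ => T) e₀ e k))
        p₀ (fun k => p' ≫ p k) k) where
  self k := by
    refine Fin.cases ?_ (fun k => ?_) k
    · exact h₀
    · change (i k ≫ i') ≫ p' ≫ p k = 𝟙 _
      rw [Category.assoc, reassoc_of% h₁, h.self]
  ne j k := by
    refine Fin.cases ?_ (fun j => ?_) j <;> refine Fin.cases ?_ (fun k => ?_) k
    · exact fun h => absurd rfl h
    · intro _
      change i₀ ≫ p' ≫ p k = 0
      rw [reassoc_of% h₂, zero_comp]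
    · intro _
      change (i j ≫ i') ≫ p₀ = 0
      rw [Category.assoc, h₃, comp_zero]
    · intro hjk
      change (i j ≫ i') ≫ p' ≫ p k = 0
      rw [Category.assoc, reassoc_of% h₁, h.ne j k fun h => hjk (congrArg _ h)]
  total := by
    rw [Fin.sum_univ_succ]
    change p₀ ≫ i₀ + ∑ k, (p' ≫ p k) ≫ i k ≫ i' = 𝟙 V
    have : ∑ k, (p' ≫ p k) ≫ i k ≫ i' = p' ≫ (∑ k, p k ≫ i k) ≫ i' := by
      simp [Preadditive.sum_comp, Preadditive.comp_sum]
    rw [this, h.total, Category.id_comp, h₄, add_sub_cancel]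

variable [HasFiniteBiproducts C]

/-- The isomorphism onto the direct sum given by a splitting. -/
def IsSplitting.iso {n : ℕ} {V : C} {X : Fin n → C} {i : ∀ k, X k ⟶ V} {p : ∀ k, V ⟶ X k}
    (h : IsSplitting i p) : V ≅ ⨁ X where
  hom := biproduct.lift p
  inv := biproduct.desc i
  hom_inv_id := by rw [biproduct.lift_desc, h.total]
  inv_hom_id := by
    ext k j
    simp only [biproduct.ι_desc_assoc, biproduct.lift_π, Category.id_comp, Category.assoc]
    by_cases hjk : j = k
    · subst hjk; rw [h.self, biproduct.ι_π_self]
    · rw [h.ne _ _ hjk, biproduct.ι_π_ne _ hjk]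

theorem isSplitting_of_iso {n : ℕ} {V : C} {X : Fin n → C} (e : V ≅ ⨁ X) :
    IsSplitting (fun k => biproduct.ι X k ≫ e.inv) (fun k => e.hom ≫ biproduct.π X k) where
  self k := by simp
  ne j k hjk := by simp [biproduct.ι_π_ne _ hjk]
  total := by
    have : ∑ k, (e.hom ≫ biproduct.π X k) ≫ biproduct.ι X k ≫ e.inv =
        e.hom ≫ (∑ k, biproduct.π X k ≫ biproduct.ι X k) ≫ e.inv := by
      simp only [Preadditive.sum_comp, Preadditive.comp_sum, Category.assoc]
    rw [this, biproduct.total, Category.id_comp, e.hom_inv_id]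

end Splittings

section Bars

variable {F : Type u} [Field F] {l : ℕ}

theorem IsSplitting.mem_bars {V : PersMod F l} {n : ℕ} {J : Fin n → Bar l}
    {i : ∀ k, intervalModule F (J k) ⟶ V} {p : ∀ k, V ⟶ intervalModule F (J k)}
    (h : IsSplitting i p) (k : Fin n) : J k ∈ bars V :=
  ⟨n, J, ⟨h.iso⟩, k, rfl⟩

theorem bars_subset_of_interval_complement {V V' : PersMod F l} {J : Bar l}
    {i₀ : intervalModule F J ⟶ V} {p₀ : V ⟶ intervalModule F J} {i' : V' ⟶ V} {p' : V ⟶ V'}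
    (h₀ : i₀ ≫ p₀ = 𝟙 _) (h₁ : i' ≫ p' = 𝟙 _) (h₂ : i₀ ≫ p' = 0) (h₃ : i' ≫ p₀ = 0)
    (h₄ : p' ≫ i' = 𝟙 V - p₀ ≫ i₀) : bars V' ⊆ bars V := by
  rintro _ ⟨n, J', ⟨e⟩, k, rfl⟩
  exact (IsSplitting.cons (intervalModule F) h₀ h₁ h₂ h₃ h₄ (isSplitting_of_iso e)).mem_bars k.succ

theorem bars_subset_of_iso {V V' : PersMod F l} (e : V ≅ V') : bars V' ⊆ bars V := by
  rintro _ ⟨n, J', ⟨e'⟩, h⟩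
  exact ⟨n, J', ⟨e ≪≫ e'⟩, h⟩

/-- A nonzero persistence module has an interval module as a direct summand. -/
theorem exists_interval_summand (V : PersMod F l) (hV : ∃ t, Nontrivial (V.obj t)) :
    ∃ (J : Bar l) (i : intervalModule F J ⟶ V) (p : V ⟶ intervalModule F J), i ≫ p = 𝟙 _ := by
  classical
  obtain ⟨t₀, ht₀⟩ := hV
  obtain ⟨a, ha, hamin⟩ := Finset.exists_min_image
    (Finset.univ.filter fun t => Nontrivial (V.obj t)) id ⟨t₀, by simpa using ht₀⟩
  replace ha := (Finset.mem_filter.1 ha).2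
  obtain ⟨x₁, hx₁⟩ := exists_ne (0 : V.obj a)
  obtain ⟨b, hb, hbmax⟩ := Finset.exists_max_image
    (Finset.univ.filter fun t => ∃ (h : a ≤ t) (x : V.obj a), V.map (homOfLE h) x ≠ 0) id
    ⟨a, Finset.mem_filter.2 ⟨Finset.mem_univ _, le_rfl, x₁, by rwa [map_self_apply]⟩⟩
  obtain ⟨hab, x, hx⟩ := (Finset.mem_filter.1 hb).2
  have hdead : ∀ t (h : a ≤ t), b < t → V.map (homOfLE h) x = 0 := by
    intro t h hbt
    by_contra hne
    exact absurd (hbmax t (Finset.mem_filter.2 ⟨Finset.mem_univ _, h, x, hne⟩)) (not_le.2 hbt)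
  have hunborn : ∀ t (y : V.obj t), t < a → y = 0 := by
    intro t y hta
    by_contra hne
    exact absurd (hamin t (Finset.mem_filter.2 ⟨Finset.mem_univ _, ⟨y, 0, hne⟩⟩)) (not_le.2 hta)
  obtain ⟨f, hf⟩ := Module.Projective.exists_dual_ne_zero F hx
  let g : V.obj b →ₗ[F] F := (f (V.map (homOfLE hab) x))⁻¹ • f
  have hg : g (V.map (homOfLE hab) x) = 1 := inv_mul_cancel₀ hf
  let J : Bar l := ⟨a, b, hab⟩
  let y : ∀ t, V.obj t := fun t => if h : a ≤ t then V.map (homOfLE h) x else 0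
  let i : intervalModule F J ⟶ V :=
    { app := fun t => ModuleCat.ofHom ((intervalCoord J t).smulRight (y t))
      naturality := by
        intro t t' φ
        ext z
        change intervalCoord J t' ((intervalModule F J).map φ z) • y t' =
          V.map φ (intervalCoord J t z • y t)
        rw [intervalCoord_map, map_smul]
        by_cases ht : J.Has t
        · have h1 : a ≤ t := ht.1
          have h2 : a ≤ t' := h1.trans (leOfHom φ)
          have h3 : V.map φ (y t) = y t' := by
            simp only [y, dif_pos h1, dif_pos h2]
            exact map_map_apply V _ _ _ _
          rw [h3]
          split_ifs with ht'
          · rfl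
          · have h4 : y t' = 0 := by
              simp only [y, dif_pos h2]
              exact hdead t' h2 (not_le.1 fun h => ht' ⟨h2, h⟩)
            rw [h4, smul_zero, smul_zero]
        · rw [intervalCoord_of_not_has ht]; simp }
  let q : ∀ t, V.obj t →ₗ[F] F := fun t => if h : t ≤ b then g ∘ₗ (V.map (homOfLE h)).hom else 0
  let p : V ⟶ intervalModule F J :=
    { app := fun t => ModuleCat.ofHom ((q t).smulRight (intervalGen F J t))
      naturality := by
        intro t t' φ
        ext z
        change q t' (V.map φ z) • intervalGen F J t' =
          (intervalModule F J).map φ (q t z • intervalGen F J t)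
        rw [map_smul]
        by_cases hta : t < a
        · rw [hunborn t z hta]; simp
        by_cases htb : t' ≤ b
        · have h1 := (leOfHom φ).trans htb
          rw [map_intervalGen J φ ⟨not_lt.1 hta, h1⟩]
          congr 1
          simp only [q, dif_pos htb, dif_pos h1]
          exact congrArg g (map_map_apply V φ (homOfLE htb) (homOfLE h1) z)
        · have h1 : ¬ J.Has t' := fun h => htb h.2
          have h2 : ∀ w, (intervalModule F J).map φ w = 0 := by
            intro w
            rw [eq_smul_intervalGen J t' ((intervalModule F J).map φ w), intervalGen_of_not_has h1,
              smul_zero]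
          rw [intervalGen_of_not_has h1, h2, smul_zero, smul_zero] }
  refine ⟨J, i, p, intervalModule_hom_ext ?_⟩
  change q a (intervalCoord J a (intervalGen F J a) • y a) • intervalGen F J a = intervalGen F J a
  have h1 : y a = x := by
    simp only [y, dif_pos le_rfl]
    exact map_self_apply V _ x
  have h2 : q a x = 1 := by
    simp only [q, dif_pos hab]
    exact hg
  rw [intervalCoord_gen, if_pos J.has_birth, one_smul, h1, h2, one_smul]

end Bars

section Dimension

variable {F : Type u} [Field F] {l : ℕ} {V V' : PersMod F l}

theorem app_injective_of_retract {i : V' ⟶ V} {p : V ⟶ V'} (h : i ≫ p = 𝟙 _) (t : Fin (l + 1)) :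
    Function.Injective (i.app t).hom := by
  refine Function.LeftInverse.injective (g := (p.app t).hom) fun x => ?_
  change (i ≫ p).app t x = x
  rw [h]; rfl

theorem finiteDimensional_of_retract (hV : ∀ t, FiniteDimensional F (V.obj t)) {i : V' ⟶ V}
    {p : V ⟶ V'} (h : i ≫ p = 𝟙 _) (t : Fin (l + 1)) : FiniteDimensional F (V'.obj t) :=
  have := hV t
  FiniteDimensional.of_injective _ (app_injective_of_retract h t)

/-- The sum of the dimensions of the spaces of a persistence module. -/
def totalDim (V : PersMod F l) : ℕ := ∑ t, Module.finrank F (V.obj t)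

theorem totalDim_le_of_retract (hV : ∀ t, FiniteDimensional F (V.obj t)) {i : V' ⟶ V}
    {p : V ⟶ V'} (h : i ≫ p = 𝟙 _) : totalDim V' ≤ totalDim V :=
  Finset.sum_le_sum fun t _ =>
    have := hV t
    LinearMap.finrank_le_finrank_of_injective (app_injective_of_retract h t)

theorem totalDim_lt_of_interval_complement (hV : ∀ t, FiniteDimensional F (V.obj t)) {i : V' ⟶ V}
    {p : V ⟶ V'} (h : i ≫ p = 𝟙 _) {J : Bar l} {i₀ : intervalModule F J ⟶ V}
    {p₀ : V ⟶ intervalModule F J} (h₀ : i₀ ≫ p₀ = 𝟙 _) (h₃ : i ≫ p₀ = 0) :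
    totalDim V' < totalDim V := by
  refine Finset.sum_lt_sum (fun t _ => ?_) ⟨J.birth, Finset.mem_univ _, ?_⟩
  · have := hV t
    exact LinearMap.finrank_le_finrank_of_injective (app_injective_of_retract h t)
  · have := hV J.birth
    rw [← LinearMap.finrank_range_of_inj (app_injective_of_retract h J.birth)]
    refine Submodule.finrank_lt fun htop => ?_
    have h1 : i₀.app J.birth (intervalGen F J J.birth) ∈ LinearMap.range (i.app J.birth).hom :=
      htop ▸ Submodule.mem_top
    obtain ⟨x, hx⟩ := h1
    have h2 : p₀.app J.birth (i.app J.birth x) = intervalGen F J J.birth := by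
      change p₀.app J.birth ((i.app J.birth).hom x) = _
      rw [hx]
      change (i₀ ≫ p₀).app J.birth (intervalGen F J J.birth) = _
      rw [h₀]; rfl
    have h3 : p₀.app J.birth (i.app J.birth x) = 0 := by
      rw [← app_comp_apply, h₃]; rfl
    have h4 := congrArg (intervalCoord J J.birth) (h2.symm.trans h3)
    rw [intervalCoord_gen, if_pos J.has_birth, map_zero] at h4
    exact one_ne_zero h4

/-- The structure theorem: a pointwise finite dimensional persistence module is a finite direct sum
of interval modules. -/
theorem exists_interval_splitting (V : PersMod F l) (hV : ∀ t, FiniteDimensional F (V.obj t)) :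
    ∃ (n : ℕ) (J : Fin n → Bar l) (i : ∀ k, intervalModule F (J k) ⟶ V)
      (p : ∀ k, V ⟶ intervalModule F (J k)), IsSplitting i p := by
  induction h : totalDim V using Nat.strong_induction_on generalizing V with
  | _ N ih =>
  by_cases h0 : ∃ t, Nontrivial (V.obj t)
  · obtain ⟨J, i₀, p₀, h₀⟩ := exists_interval_summand V h0
    obtain ⟨V', i', p', h₁, h₂, h₃, h₄⟩ := exists_complement h₀
    obtain ⟨n, J', i, p, hip⟩ := ih _
      (h ▸ totalDim_lt_of_interval_complement hV h₁ h₀ h₃) V'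
      (finiteDimensional_of_retract hV h₁) rfl
    exact ⟨n + 1, _, _, _, IsSplitting.cons (intervalModule F) h₀ h₁ h₂ h₃ h₄ hip⟩
  · refine ⟨0, Fin.elim0, fun k => k.elim0, fun k => k.elim0, fun k => k.elim0,
      fun k => k.elim0, ?_⟩
    refine hom_ext_apply fun t x => ?_
    simp only [not_exists, not_nontrivial_iff_subsingleton] at h0
    have := h0 t
    exact Subsingleton.elim _ _

end Dimension

section LadderSplitting

variable {F : Type u} [Field F] {l : ℕ}

theorem bars_subset_of_zero_complement {V V' X : PersMod F l} (hX : IsZero X)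
    {i₀ : X ⟶ V} {p₀ : V ⟶ X} {i' : V' ⟶ V} {p' : V ⟶ V'}
    (h₁ : i' ≫ p' = 𝟙 _) (h₄ : p' ≫ i' = 𝟙 V - p₀ ≫ i₀) : bars V' ⊆ bars V := by
  refine bars_subset_of_iso ⟨p', i', ?_, h₁⟩
  rw [h₄, hX.eq_of_tgt p₀ 0, zero_comp, sub_zero]

theorem bars_subset_of_source_complement (E : Elementary l) {V V' : PersMod F l}
    {i₀ : (E.arrow F).left ⟶ V} {p₀ : V ⟶ (E.arrow F).left} {i' : V' ⟶ V} {p' : V ⟶ V'}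
    (h₀ : i₀ ≫ p₀ = 𝟙 _) (h₁ : i' ≫ p' = 𝟙 _) (h₂ : i₀ ≫ p' = 0) (h₃ : i' ≫ p₀ = 0)
    (h₄ : p' ≫ i' = 𝟙 V - p₀ ≫ i₀) : bars V' ⊆ bars V := by
  cases E with
  | R K J h => exact bars_subset_of_interval_complement (J := J) h₀ h₁ h₂ h₃ h₄
  | plus J => exact bars_subset_of_interval_complement (J := J) h₀ h₁ h₂ h₃ h₄
  | minus K => exact bars_subset_of_zero_complement (isZero_zero (PersMod F l)) h₁ h₄

theorem bars_subset_of_target_complement (E : Elementary l) {V V' : PersMod F l}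
    {i₀ : (E.arrow F).right ⟶ V} {p₀ : V ⟶ (E.arrow F).right} {i' : V' ⟶ V} {p' : V ⟶ V'}
    (h₀ : i₀ ≫ p₀ = 𝟙 _) (h₁ : i' ≫ p' = 𝟙 _) (h₂ : i₀ ≫ p' = 0) (h₃ : i' ≫ p₀ = 0)
    (h₄ : p' ≫ i' = 𝟙 V - p₀ ≫ i₀) : bars V' ⊆ bars V := by
  cases E with
  | R K J h => exact bars_subset_of_interval_complement (J := K) h₀ h₁ h₂ h₃ h₄
  | plus J => exact bars_subset_of_zero_complement (isZero_zero (PersMod F l)) h₁ h₄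
  | minus K => exact bars_subset_of_interval_complement (J := K) h₀ h₁ h₂ h₃ h₄

theorem totalDim_lt_of_elementary_complement (E : Elementary l) {V V' W W' : PersMod F l}
    (hV : ∀ t, FiniteDimensional F (V.obj t)) (hW : ∀ t, FiniteDimensional F (W.obj t))
    {iL : (E.arrow F).left ⟶ V} {pL : V ⟶ (E.arrow F).left} (hL : iL ≫ pL = 𝟙 _)
    {iR : (E.arrow F).right ⟶ W} {pR : W ⟶ (E.arrow F).right} (hR : iR ≫ pR = 𝟙 _)
    {iV : V' ⟶ V} {pV : V ⟶ V'} (hiV : iV ≫ pV = 𝟙 _) (hV' : iV ≫ pL = 0)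
    {iW : W' ⟶ W} {pW : W ⟶ W'} (hiW : iW ≫ pW = 𝟙 _) (hW' : iW ≫ pR = 0) :
    totalDim V' + totalDim W' < totalDim V + totalDim W := by
  cases E with
  | R K J h =>
    exact Nat.add_lt_add_of_lt_of_le
      (totalDim_lt_of_interval_complement (J := J) hV hiV hL hV') (totalDim_le_of_retract hW hiW)
  | plus J =>
    exact Nat.add_lt_add_of_lt_of_le
      (totalDim_lt_of_interval_complement (J := J) hV hiV hL hV') (totalDim_le_of_retract hW hiW)
  | minus K =>
    exact Nat.add_lt_add_of_le_of_lt (totalDim_le_of_retract hV hiV)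
      (totalDim_lt_of_interval_complement (J := K) hW hiW hR hW')

/-- The restriction of a shifted morphism to retracts. -/
def ShiftHom.restrict {V W V' W' : PersMod F l} {s : ℕ} (Ψ : ShiftHom W V s) (i : W' ⟶ W)
    (p : V ⟶ V') : ShiftHom W' V' s where
  app t u hu := i.app t ≫ Ψ.app t u hu ≫ p.app u
  naturality t t' u u' hu hu' f g := by
    rw [i.naturality_assoc, reassoc_of% Ψ.naturality t t' u u' hu hu' f g, p.naturality]
    simp only [Category.assoc]

theorem AlmostInverse.restrict {V W V' W' : PersMod F l} {Φ : V ⟶ W} {s m : ℕ}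
    {Ψ : ShiftHom W V s} (h : AlmostInverse Φ Ψ m) {iV : V' ⟶ V} {pV : V ⟶ V'} {iW : W' ⟶ W}
    {pW : W ⟶ W'} {Φ' : V' ⟶ W'} (hV : iV ≫ pV = 𝟙 _) (hW : iW ≫ pW = 𝟙 _)
    (hi : iV ≫ Φ = Φ' ≫ iW) (hp : Φ ≫ pW = pV ≫ Φ') :
    AlmostInverse Φ' (Ψ.restrict iW pV) m where
  left t u u' hu hm f g x := by
    change V'.map f (pV.app u (Ψ.app t u hu (iW.app t (Φ'.app t x)))) = _
    rw [← app_comp_apply Φ', ← hi, app_comp_apply, ← app_map_apply, h.left t u u' hu hm f g,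
      app_map_apply, ← app_comp_apply, hV]
    rfl
  right t u u' hu hm f g x := by
    change W'.map f (Φ'.app u (pV.app u (Ψ.app t u hu (iW.app t x)))) = _
    rw [← app_comp_apply pV, ← hp, app_comp_apply, ← app_map_apply, h.right t u u' hu hm f g,
      app_map_apply, ← app_comp_apply, hW]
    rfl

/-- A nonzero ladder persistence module whose morphism is almost invertible and whose strictly
nested bars are far apart has an elementary direct summand. -/
theorem exists_elementary_arrow_summand {V W : PersMod F l}
    (hV : ∀ t, FiniteDimensional F (V.obj t)) (hW : ∀ t, FiniteDimensional F (W.obj t))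
    {Φ : V ⟶ W} {s m : ℕ} {Ψ : ShiftHom W V s} (hΨ : AlmostInverse Φ Ψ m)
    (hbV : ∀ J ∈ bars V, ∀ K ∈ bars V, J.StrictlyNested K → J.Far s m K)
    (hbW : ∀ J ∈ bars W, ∀ K ∈ bars W, J.StrictlyNested K → J.Far s m K)
    (hne : (∃ t, Nontrivial (V.obj t)) ∨ ∃ t, Nontrivial (W.obj t)) :
    ∃ (E : Elementary l) (iL : (E.arrow F).left ⟶ V) (pL : V ⟶ (E.arrow F).left)
      (iR : (E.arrow F).right ⟶ W) (pR : W ⟶ (E.arrow F).right),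
      iL ≫ pL = 𝟙 _ ∧ iR ≫ pR = 𝟙 _ ∧ iL ≫ Φ = (E.arrow F).hom ≫ iR ∧
        Φ ≫ pR = pL ≫ (E.arrow F).hom := by
  have hz : (0 : (0 : PersMod F l) ⟶ W) ≫ (0 : W ⟶ 0) = 𝟙 _ := (isZero_zero _).eq_of_src _ _
  have hz' : (0 : (0 : PersMod F l) ⟶ V) ≫ (0 : V ⟶ 0) = 𝟙 _ := (isZero_zero _).eq_of_src _ _
  by_cases hΦ : Φ = 0
  · rcases hne with h | h
    · obtain ⟨J, i, p, hip⟩ := exists_interval_summand V h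
      have hi : i ≫ Φ = (0 : intervalModule F J ⟶ 0) ≫ (0 : 0 ⟶ W) := by
        rw [hΦ, comp_zero, zero_comp]
      exact ⟨.plus J, i, p, (0 : 0 ⟶ W), (0 : W ⟶ 0), hip, hz, hi,
        (isZero_zero (PersMod F l)).eq_of_tgt _ _⟩
    · obtain ⟨K, i, p, hip⟩ := exists_interval_summand W h
      have hp : Φ ≫ p = (0 : V ⟶ 0) ≫ (0 : 0 ⟶ intervalModule F K) := by
        rw [hΦ, zero_comp, zero_comp]
      exact ⟨.minus K, (0 : 0 ⟶ V), (0 : V ⟶ 0), i, p, hz', hip,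
        (isZero_zero (PersMod F l)).eq_of_src _ _, hp⟩
  · obtain ⟨n, I, i, p, hip⟩ := exists_interval_splitting V hV
    obtain ⟨n', I', i', p', hip'⟩ := exists_interval_splitting W hW
    obtain ⟨J, K, h, iJ, pJ, iK, pK, h1, h2, h3, h4⟩ := exists_elementary_summand hΨ hip hip'
      (fun j k => hbV _ (hip.mem_bars j) _ (hip.mem_bars k))
      (fun j k => hbW _ (hip'.mem_bars j) _ (hip'.mem_bars k)) hΦ
    exact ⟨.R K J h, iJ, pJ, iK, pK, h1, h2, h3, h4⟩

/-- An almost invertible morphism between persistence modules whose strictly nested bars are far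
apart is a direct sum of elementary ladder persistence modules. -/
theorem exists_elementary_splitting {V W : PersMod F l}
    (hV : ∀ t, FiniteDimensional F (V.obj t)) (hW : ∀ t, FiniteDimensional F (W.obj t))
    {Φ : V ⟶ W} {s m : ℕ} {Ψ : ShiftHom W V s} (hΨ : AlmostInverse Φ Ψ m)
    (hbV : ∀ J ∈ bars V, ∀ K ∈ bars V, J.StrictlyNested K → J.Far s m K)
    (hbW : ∀ J ∈ bars W, ∀ K ∈ bars W, J.StrictlyNested K → J.Far s m K) :
    ∃ (n : ℕ) (E : Fin n → Elementary l) (iL : ∀ k, ((E k).arrow F).left ⟶ V)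
      (pL : ∀ k, V ⟶ ((E k).arrow F).left) (iR : ∀ k, ((E k).arrow F).right ⟶ W)
      (pR : ∀ k, W ⟶ ((E k).arrow F).right), IsSplitting iL pL ∧ IsSplitting iR pR ∧
        ∀ k, iL k ≫ Φ = ((E k).arrow F).hom ≫ iR k := by
  induction h : totalDim V + totalDim W using Nat.strong_induction_on generalizing V W with
  | _ N ih =>
  by_cases hne : (∃ t, Nontrivial (V.obj t)) ∨ ∃ t, Nontrivial (W.obj t)
  · obtain ⟨E₀, iL₀, pL₀, iR₀, pR₀, hL₀, hR₀, hi, hp⟩ :=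
      exists_elementary_arrow_summand hV hW hΨ hbV hbW hne
    obtain ⟨V', iV, pV, hV₁, hV₂, hV₃, hV₄⟩ := exists_complement hL₀
    obtain ⟨W', iW, pW, hW₁, hW₂, hW₃, hW₄⟩ := exists_complement hR₀
    have hi' : iV ≫ Φ = (iV ≫ Φ ≫ pW) ≫ iW := by
      rw [Category.assoc, Category.assoc, hW₄, Preadditive.comp_sub, reassoc_of% hp,
        Category.comp_id, Preadditive.comp_sub, reassoc_of% hV₃, zero_comp, sub_zero]
    have hp' : Φ ≫ pW = pV ≫ iV ≫ Φ ≫ pW := by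
      rw [reassoc_of% hV₄, Preadditive.sub_comp, Category.assoc, reassoc_of% hi, hW₂, comp_zero,
        comp_zero, sub_zero, Category.id_comp]
    have hsV := bars_subset_of_source_complement E₀ hL₀ hV₁ hV₂ hV₃ hV₄
    have hsW := bars_subset_of_target_complement E₀ hR₀ hW₁ hW₂ hW₃ hW₄
    obtain ⟨n, E, iL, pL, iR, pR, hL, hR, hE⟩ := ih _
      (h ▸ totalDim_lt_of_elementary_complement E₀ hV hW hL₀ hR₀ hV₁ hV₃ hW₁ hW₃)
      (finiteDimensional_of_retract hV hV₁) (finiteDimensional_of_retract hW hW₁)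
      (hΨ.restrict hV₁ hW₁ hi' hp')
      (fun J hJ K hK => hbV J (hsV hJ) K (hsV hK))
      (fun J hJ K hK => hbW J (hsW hJ) K (hsW hK)) rfl
    refine ⟨n + 1, Fin.cons E₀ E, _, _, _, _,
      IsSplitting.cons (fun E : Elementary l => (E.arrow F).left) hL₀ hV₁ hV₂ hV₃ hV₄ hL,
      IsSplitting.cons (fun E : Elementary l => (E.arrow F).right) hR₀ hW₁ hW₂ hW₃ hW₄ hR,
      fun k => ?_⟩
    refine Fin.cases ?_ (fun k => ?_) k
    · exact hi
    · change (iL k ≫ iV) ≫ Φ = ((E k).arrow F).hom ≫ iR k ≫ iW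
      rw [Category.assoc, hi', ← Category.assoc, hE k, Category.assoc]
  · simp only [not_or, not_exists, not_nontrivial_iff_subsingleton] at hne
    refine ⟨0, Fin.elim0, fun k => k.elim0, fun k => k.elim0, fun k => k.elim0, fun k => k.elim0,
      ⟨fun k => k.elim0, fun k => k.elim0, ?_⟩, ⟨fun k => k.elim0, fun k => k.elim0, ?_⟩,
      fun k => k.elim0⟩
    · refine hom_ext_apply fun t x => ?_
      have := hne.1 t
      exact Subsingleton.elim _ _
    · refine hom_ext_apply fun t x => ?_
      have := hne.2 t
      exact Subsingleton.elim _ _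

end LadderSplitting

section Generators

variable {F : Type u} [Field F] {l : ℕ}

/-- A family of generators of the persistence module `V`, each alive on an interval, such that the
generators alive at the index `t` form a basis of `V_t`. -/
structure Generators (V : PersMod F l) (κ : Type*) [Fintype κ] where
  alive : κ → Fin (l + 1) → Prop
  birth : κ → Fin (l + 1)
  gen : ∀ (_ : κ) (t : Fin (l + 1)), V.obj t
  coord : ∀ (_ : κ) (t : Fin (l + 1)), V.obj t →ₗ[F] F
  birth_le : ∀ {k t}, alive k t → birth k ≤ t
  alive_of_le : ∀ {k t t'}, alive k t → birth k ≤ t' → t' ≤ t → alive k t'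
  gen_eq_zero : ∀ {k t}, ¬ alive k t → gen k t = 0
  coord_self : ∀ {k t}, alive k t → coord k t (gen k t) = 1
  coord_ne : ∀ {j k}, j ≠ k → ∀ t, coord j t (gen k t) = 0
  sum_coord : ∀ t (x : V.obj t), ∑ k, coord k t x • gen k t = x
  map_gen : ∀ {k t t'} (f : t ⟶ t'), alive k t → V.map f (gen k t) = gen k t'

/-- The generators alive at `t`. -/
def Generators.set {V : PersMod F l} {κ : Type*} [Fintype κ] (G : Generators V κ)
    (t : Fin (l + 1)) : Set (V.obj t) :=
  {x | ∃ k, G.alive k t ∧ G.gen k t = x}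

namespace Generators

open Classical in
/-- The indices of the generators alive at `t`. -/
def support {V : PersMod F l} {κ : Type*} [Fintype κ] (G : Generators V κ) (t : Fin (l + 1)) :
    Finset κ := Finset.univ.filter fun k => G.alive k t

variable {V : PersMod F l} {κ : Type*} [Fintype κ] (G : Generators V κ)

theorem mem_support {k : κ} {t : Fin (l + 1)} : k ∈ G.support t ↔ G.alive k t := by
  simp [support]

theorem sum_support (t : Fin (l + 1)) (c : κ → F) :
    ∑ k : G.support t, c k • G.gen k t = ∑ k, c k • G.gen k t := by
  rw [Finset.sum_coe_sort (G.support t) fun k => c k • G.gen k t]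
  refine Finset.sum_subset (Finset.subset_univ _) fun k _ hk => ?_
  rw [G.gen_eq_zero fun h => hk (G.mem_support.2 h), smul_zero]

/-- The basis of `V_t` formed by the generators alive at `t`. -/
def basisAt (t : Fin (l + 1)) : Module.Basis (G.support t) F (V.obj t) :=
  Module.Basis.ofEquivFun
    { toFun := fun x k => G.coord k t x
      map_add' := fun x y => by ext k; simp
      map_smul' := fun c x => by ext k; simp
      invFun := fun c => ∑ k, c k • G.gen k t
      left_inv := fun x => (G.sum_support t fun k => G.coord k t x).trans (G.sum_coord t x)
      right_inv := fun c => by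
        classical
        ext j
        dsimp only
        rw [map_sum, Finset.sum_eq_single j]
        · rw [map_smul, G.coord_self (G.mem_support.1 j.2), smul_eq_mul, mul_one]
        · intro k _ hk
          rw [map_smul, G.coord_ne (fun h => hk (Subtype.ext h.symm)), smul_zero]
        · exact fun h => absurd (Finset.mem_univ _) h }

theorem basisAt_repr (t : Fin (l + 1)) (x : V.obj t) (k : G.support t) :
    (G.basisAt t).repr x k = G.coord k t x := rfl

theorem basisAt_apply (t : Fin (l + 1)) (k : G.support t) : G.basisAt t k = G.gen k t := by
  classical
  refine (G.basisAt t).repr.injective (Finsupp.ext fun j => ?_)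
  rw [G.basisAt_repr t (G.gen k t), Module.Basis.repr_self, Finsupp.single_apply]
  split_ifs with h
  · rw [h, G.coord_self (G.mem_support.1 j.2)]
  · rw [G.coord_ne fun h' => h (Subtype.ext h'.symm)]

theorem card_support (t : Fin (l + 1)) :
    (G.support t).card = Module.finrank F (V.obj t) := by
  rw [Module.finrank_eq_card_basis (G.basisAt t), Fintype.card_coe]

theorem finrank_range_map [DecidableEq κ] {t t' : Fin (l + 1)} (f : t ⟶ t') :
    Module.finrank F (LinearMap.range (V.map f).hom) = (G.support t ∩ G.support t').card := by
  let T := G.support t ∩ G.support t'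
  have hT : ∀ k ∈ T, G.alive k t ∧ G.alive k t' := fun k hk =>
    ⟨G.mem_support.1 (Finset.mem_inter.1 hk).1, G.mem_support.1 (Finset.mem_inter.1 hk).2⟩
  have hli : LinearIndependent F (fun k : T => G.gen k t') := by
    have h1 := (G.basisAt t').linearIndependent.comp
      (fun k : T => (⟨k, (Finset.mem_inter.1 k.2).2⟩ : G.support t'))
      (fun a b h => Subtype.ext (congrArg (fun x : G.support t' => (x : κ)) h))
    convert h1 using 2 with k
    exact (G.basisAt_apply t' ⟨k, (Finset.mem_inter.1 k.2).2⟩).symm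
  have hrange : LinearMap.range (V.map f).hom =
      Submodule.span F (Set.range fun k : T => G.gen k t') := by
    apply le_antisymm
    · rintro _ ⟨x, rfl⟩
      rw [← G.sum_coord t x, map_sum]
      refine Submodule.sum_mem _ fun k _ => ?_
      rw [map_smul]
      refine Submodule.smul_mem _ _ ?_
      change V.map f (G.gen k t) ∈ _
      by_cases hk : G.alive k t
      · rw [G.map_gen f hk]
        by_cases hk' : G.alive k t'
        · exact Submodule.subset_span
            ⟨⟨k, Finset.mem_inter.2 ⟨G.mem_support.2 hk, G.mem_support.2 hk'⟩⟩, rfl⟩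
        · rw [G.gen_eq_zero hk']; exact Submodule.zero_mem _
      · rw [G.gen_eq_zero hk, map_zero]; exact Submodule.zero_mem _
    · rw [Submodule.span_le]
      rintro _ ⟨k, rfl⟩
      exact ⟨G.gen k t, G.map_gen f (hT k k.2).1⟩
  rw [hrange, finrank_span_eq_card hli, Fintype.card_coe]

end Generators

/-- The elements of a lower subset are enumerated first. -/
theorem _root_.Finset.orderEmbOfFin_mem_iff {α : Type*} [LinearOrder α] {s T : Finset α} {n : ℕ}
    (h : s.card = n) (hT : T ⊆ s) (hlow : ∀ a ∈ s, ∀ b ∈ T, a ≤ b → a ∈ T) (x : Fin n) :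
    s.orderEmbOfFin h x ∈ T ↔ (x : ℕ) < T.card := by
  classical
  let P : Finset (Fin n) := Finset.univ.filter fun y => s.orderEmbOfFin h y ∈ T
  have hP : P.card = T.card := by
    refine Finset.card_bij (fun y _ => s.orderEmbOfFin h y) (fun y hy => (Finset.mem_filter.1 hy).2)
      (fun y _ z _ hyz => (s.orderEmbOfFin h).injective hyz) fun b hb => ?_
    have hb' : b ∈ Set.range (s.orderEmbOfFin h) := by
      rw [Finset.range_orderEmbOfFin]; exact hT hb
    obtain ⟨y, rfl⟩ := hb'
    exact ⟨y, Finset.mem_filter.2 ⟨Finset.mem_univ _, hb⟩, rfl⟩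
  rw [← hP]
  constructor
  · intro hx
    have h1 : Finset.Iic x ⊆ P := fun y hy => Finset.mem_filter.2 ⟨Finset.mem_univ _,
      hlow _ (s.orderEmbOfFin_mem h y) _ hx
        ((s.orderEmbOfFin h).monotone (Finset.mem_Iic.1 hy))⟩
    have h2 := Finset.card_le_card h1
    rw [Fin.card_Iic] at h2
    omega
  · intro hx
    by_contra hn
    have h1 : P ⊆ Finset.Iio x := by
      intro y hy
      rw [Finset.mem_Iio]
      by_contra! hxy
      exact hn (hlow _ (s.orderEmbOfFin_mem h x) _ (Finset.mem_filter.1 hy).2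
        ((s.orderEmbOfFin h).monotone hxy))
    have h2 := Finset.card_le_card h1
    rw [Fin.card_Iio] at h2
    omega

/-- Generators ordered by birth form a barcode basis. -/
theorem Generators.exists_barcodeBasis_of_monotone {V : PersMod F l} {κ : Type*} [Fintype κ]
    [LinearOrder κ] (G : Generators V κ) (hG : Monotone G.birth) :
    ∃ B : BarcodeBasis V, ∀ t, Set.range (B.basis t) = G.set t := by
  let o := fun t => (G.support t).orderIsoOfFin (G.card_support t)
  let b := fun t => (G.basisAt t).reindex (o t).symm.toEquiv
  have hb : ∀ t x, b t x = G.gen (o t x) t := fun t x => by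
    simp only [b, Module.Basis.reindex_apply]
    exact G.basisAt_apply t _
  have hr : ∀ t (v : V.obj t) x, (b t).repr v x = G.coord (o t x) t v := fun t v x => by
    simp only [b, Module.Basis.repr_reindex_apply]
    rfl
  have ho : ∀ t x, G.alive (o t x) t := fun t x => G.mem_support.1 (o t x).2
  refine ⟨⟨b, fun i => ?_⟩, fun t => ?_⟩
  · set t := i.castSucc with ht
    set t' := i.succ with ht'
    have htt' : (t' : ℕ) = t + 1 := by simp [ht, ht']
    set f : t ⟶ t' := homOfLE (Fin.castSucc_lt_succ (i := i)).le with hf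
    set A := LinearMap.toMatrix (b t) (b t') (V.map f).hom with hA
    have hAv : ∀ x y, A x y = if (o t' x : κ) = o t y then 1 else 0 := by
      intro x y
      rw [hA, LinearMap.toMatrix_apply, hr, hb]
      change G.coord _ _ (V.map f _) = _
      rw [G.map_gen f (ho t y)]
      split_ifs with h
      · rw [← h, G.coord_self (ho t' x)]
      · rw [G.coord_ne h]
    let T := G.support t ∩ G.support t'
    have hrank : A.rank = T.card := by
      rw [Matrix.rank_eq_finrank_range_toLin A (b t') (b t), hA, Matrix.toLin_toMatrix,
        G.finrank_range_map]
    have hlow : ∀ j ∈ G.support t', ∀ k ∈ T, j ≤ k → j ∈ T := by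
      intro j hj k hk hjk
      rw [Finset.mem_inter, G.mem_support, G.mem_support] at hk
      refine Finset.mem_inter.2 ⟨G.mem_support.2 ?_, hj⟩
      exact G.alive_of_le (G.mem_support.1 hj) ((hG hjk).trans (G.birth_le hk.1)) (leOfHom f)
    have hmem : ∀ x, (o t' x : κ) ∈ T ↔ (x : ℕ) < A.rank := fun x => by
      rw [hrank]
      exact Finset.orderEmbOfFin_mem_iff (G.card_support t') Finset.inter_subset_right hlow x
    have hle : A.rank ≤ Module.finrank F (V.obj t') := by
      rw [hrank, ← G.card_support]
      exact Finset.card_le_card Finset.inter_subset_right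
    let x : Fin A.rank → Fin (Module.finrank F (V.obj t')) := Fin.castLE hle
    have hx : ∀ r, (o t' (x r) : κ) ∈ G.support t := fun r =>
      (Finset.mem_inter.1 ((hmem (x r)).2 r.2)).1
    refine ⟨fun r => (o t).symm ⟨o t' (x r), hx r⟩, ?_, ?_, ?_⟩
    · intro r r' hrr
      refine (o t).symm.strictMono ?_
      exact (o t').strictMono (show x r < x r' from hrr)
    · rintro y z ⟨h, rfl⟩
      rw [hAv, OrderIso.apply_symm_apply, if_pos]
      rfl
    · intro y z h
      rw [hAv, if_neg]
      intro hyz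
      have hyT : (o t' y : κ) ∈ T := Finset.mem_inter.2 ⟨hyz ▸ (o t z).2, (o t' y).2⟩
      refine h ⟨(hmem y).1 hyT, ?_⟩
      rw [← OrderIso.symm_apply_apply (o t) z]
      congr 1
      exact Subtype.ext hyz.symm
  · ext v
    constructor
    · rintro ⟨x, rfl⟩
      exact ⟨o t x, ho t x, (hb t x).symm⟩
    · rintro ⟨k, hk, rfl⟩
      refine ⟨(o t).symm ⟨k, G.mem_support.2 hk⟩, ?_⟩
      rw [hb, OrderIso.apply_symm_apply]

theorem Generators.exists_barcodeBasis {V : PersMod F l} {κ : Type*} [Fintype κ]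
    (G : Generators V κ) : ∃ B : BarcodeBasis V, ∀ t, Set.range (B.basis t) = G.set t := by
  let key : κ → Lex (Fin (l + 1) × Fin (Fintype.card κ)) := fun k =>
    toLex (G.birth k, Fintype.equivFin κ k)
  have hkey : Function.Injective key := fun j k h =>
    (Fintype.equivFin κ).injective (congrArg (fun x => (ofLex x).2) h)
  let _ : LinearOrder κ := LinearOrder.lift' key hkey
  refine G.exists_barcodeBasis_of_monotone fun j k h => ?_
  have h1 : key j ≤ key k := h
  rw [Prod.Lex.toLex_le_toLex] at h1
  rcases h1 with h1 | h1
  · exact h1.le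
  · exact h1.1.le

end Generators

section Standard

variable {F : Type u} [Field F] {l : ℕ}

/-- The generator of an interval module. -/
def intervalGenerators (J : Bar l) : Generators (intervalModule F J) Unit where
  alive _ t := J.Has t
  birth _ := J.birth
  gen _ t := intervalGen F J t
  coord _ t := intervalCoord J t
  birth_le h := h.1
  alive_of_le h h1 h2 := ⟨h1, h2.trans h.2⟩
  gen_eq_zero h := intervalGen_of_not_has h
  coord_self h := by rw [intervalCoord_gen, if_pos h]
  coord_ne h := absurd rfl h
  sum_coord t x := by
    rw [Finset.univ_unique, Finset.sum_singleton]
    exact (eq_smul_intervalGen J t x).symm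
  map_gen f h := map_intervalGen J f h

theorem intervalGenerators_set (J : Bar l) (t : Fin (l + 1)) :
    (intervalGenerators (F := F) J).set t = intervalBasis F J t := by
  ext x
  constructor
  · rintro ⟨_, h, rfl⟩
    exact ⟨h, if_pos h⟩
  · rintro ⟨h, hx⟩
    refine ⟨(), h, intervalCoord_injective J t ?_⟩
    change intervalCoord J t (intervalGen F J t) = _
    rw [intervalCoord_gen, if_pos h]
    exact hx.symm

/-- The zero module has no living generators. -/
def zeroGenerators {V : PersMod F l} (hV : IsZero V) : Generators V Unit where
  alive _ _ := False
  birth _ := 0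
  gen _ _ := 0
  coord _ _ := 0
  birth_le h := h.elim
  alive_of_le h := h.elim
  gen_eq_zero _ := rfl
  coord_self h := h.elim
  coord_ne h := absurd rfl h
  sum_coord t x := by
    have h1 : x = (𝟙 V : V ⟶ V).app t x := rfl
    rw [h1, hV.eq_of_src (𝟙 V) 0, app_zero_apply]
    simp
  map_gen _ h := h.elim

theorem zeroGenerators_set {V : PersMod F l} (hV : IsZero V) (t : Fin (l + 1)) :
    (zeroGenerators hV).set t = ∅ :=
  Set.eq_empty_of_forall_notMem fun _ ⟨_, h, _⟩ => h

/-- The generator of the domain of an elementary ladder module. -/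
def Elementary.sourceGenerators : (E : Elementary l) → Generators (E.arrow F).left Unit
  | .R _ J _ => intervalGenerators J
  | .plus J => intervalGenerators J
  | .minus _ => zeroGenerators (isZero_zero (PersMod F l))

/-- The generator of the codomain of an elementary ladder module. -/
def Elementary.targetGenerators : (E : Elementary l) → Generators (E.arrow F).right Unit
  | .R K _ _ => intervalGenerators K
  | .plus _ => zeroGenerators (isZero_zero (PersMod F l))
  | .minus K => intervalGenerators K

theorem Elementary.sourceGenerators_set (E : Elementary l) (t : Fin (l + 1)) :
    (E.sourceGenerators (F := F)).set t = E.sourceBasis F t := by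
  cases E with
  | R K J h => exact intervalGenerators_set J t
  | plus J => exact intervalGenerators_set J t
  | minus K => exact zeroGenerators_set (isZero_zero (PersMod F l)) t

theorem Elementary.targetGenerators_set (E : Elementary l) (t : Fin (l + 1)) :
    (E.targetGenerators (F := F)).set t = E.targetBasis F t := by
  cases E with
  | R K J h => exact intervalGenerators_set K t
  | plus J => exact zeroGenerators_set (isZero_zero (PersMod F l)) t
  | minus K => exact intervalGenerators_set K t

/-- The generators of a direct sum whose summands have one generator each. -/
def IsSplitting.generators {V : PersMod F l} {κ : Type*} [Fintype κ] {X : κ → PersMod F l}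
    {i : ∀ k, X k ⟶ V} {p : ∀ k, V ⟶ X k} (h : IsSplitting i p)
    (G : ∀ k, Generators (X k) Unit) : Generators V κ where
  alive k t := (G k).alive () t
  birth k := (G k).birth ()
  gen k t := (i k).app t ((G k).gen () t)
  coord k t := (G k).coord () t ∘ₗ ((p k).app t).hom
  birth_le := (G _).birth_le
  alive_of_le := (G _).alive_of_le
  gen_eq_zero h := by rw [(G _).gen_eq_zero h, map_zero]
  coord_self {k t} hk := by
    change (G k).coord () t ((p k).app t ((i k).app t _)) = 1
    rw [← app_comp_apply, h.self]
    exact (G k).coord_self hk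
  coord_ne {j k} hjk t := by
    change (G j).coord () t ((p j).app t ((i k).app t _)) = 0
    rw [← app_comp_apply, h.ne _ _ hjk.symm, app_zero_apply, map_zero]
  sum_coord t x := by
    conv_rhs => rw [← h.sum_apply t x]
    refine Finset.sum_congr rfl fun k _ => ?_
    rw [← map_smul]
    congr 1
    have := (G k).sum_coord t ((p k).app t x)
    rwa [Finset.univ_unique, Finset.sum_singleton] at this
  map_gen f hk := by rw [← app_map_apply, (G _).map_gen f hk]

theorem IsSplitting.generators_set {V : PersMod F l} {κ : Type*} [Fintype κ] {X : κ → PersMod F l}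
    {i : ∀ k, X k ⟶ V} {p : ∀ k, V ⟶ X k} (h : IsSplitting i p)
    (G : ∀ k, Generators (X k) Unit) (t : Fin (l + 1)) :
    (h.generators G).set t = ⋃ k, (fun x => (i k).app t x) '' (G k).set t := by
  ext x
  simp only [Set.mem_iUnion]
  constructor
  · rintro ⟨k, hk, rfl⟩
    exact ⟨k, _, ⟨(), hk, rfl⟩, rfl⟩
  · rintro ⟨k, _, ⟨_, hk, rfl⟩, rfl⟩
    exact ⟨k, hk, rfl⟩

theorem IsSplitting.image_generators_set {V : PersMod F l} {n : ℕ} {X : Fin n → PersMod F l}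
    {i : ∀ k, X k ⟶ V} {p : ∀ k, V ⟶ X k} (h : IsSplitting i p)
    (G : ∀ k, Generators (X k) Unit) (t : Fin (l + 1)) :
    (fun x => h.iso.hom.app t x) '' (h.generators G).set t =
      ⋃ k, (fun x => (biproduct.ι X k).app t x) '' (G k).set t := by
  have h1 : ∀ k, i k ≫ h.iso.hom = biproduct.ι X k := fun k => by
    rw [← Iso.eq_comp_inv]
    exact (biproduct.ι_desc i k).symm
  rw [h.generators_set, Set.image_iUnion]
  refine Set.iUnion_congr fun k => ?_
  rw [Set.image_image, ← h1 k]
  rfl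

theorem IsSplitting.iso_hom_comp_map {C : Type*} [Category* C] [Preadditive C]
    [HasFiniteBiproducts C] {V W : C} {Φ : V ⟶ W} {n : ℕ} {X Y : Fin n → C}
    {iL : ∀ k, X k ⟶ V} {pL : ∀ k, V ⟶ X k} {iR : ∀ k, Y k ⟶ W} {pR : ∀ k, W ⟶ Y k}
    (hL : IsSplitting iL pL) (hR : IsSplitting iR pR) {f : ∀ k, X k ⟶ Y k}
    (h : ∀ k, iL k ≫ Φ = f k ≫ iR k) :
    hL.iso.hom ≫ biproduct.map f = Φ ≫ hR.iso.hom := by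
  rw [← Iso.eq_inv_comp, ← Category.assoc, ← Iso.comp_inv_eq]
  refine biproduct.hom_ext' _ _ fun k => ?_
  change biproduct.ι X k ≫ biproduct.map f ≫ biproduct.desc iR =
    biproduct.ι X k ≫ biproduct.desc iL ≫ Φ
  rw [biproduct.ι_desc_assoc, h k, biproduct.ι_map_assoc, biproduct.ι_desc]

/-- A splitting into elementary ladder modules is a decomposition in barcode bases. -/
theorem exists_decomposesIn {V W : PersMod F l} {Φ : V ⟶ W} {n : ℕ} {E : Fin n → Elementary l}
    {iL : ∀ k, ((E k).arrow F).left ⟶ V} {pL : ∀ k, V ⟶ ((E k).arrow F).left}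
    {iR : ∀ k, ((E k).arrow F).right ⟶ W} {pR : ∀ k, W ⟶ ((E k).arrow F).right}
    (hL : IsSplitting iL pL) (hR : IsSplitting iR pR)
    (h : ∀ k, iL k ≫ Φ = ((E k).arrow F).hom ≫ iR k) :
    ∃ (B : BarcodeBasis V) (C : BarcodeBasis W) (G : Generators V (Fin n))
      (H : Generators W (Fin n)), DecomposesIn Φ B C ∧
      (∀ t, Set.range (B.basis t) = G.set t) ∧ ∀ t, Set.range (C.basis t) = H.set t := by
  let G := hL.generators fun k => (E k).sourceGenerators
  let H := hR.generators fun k => (E k).targetGenerators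
  obtain ⟨B, hB⟩ := G.exists_barcodeBasis
  obtain ⟨C, hC⟩ := H.exists_barcodeBasis
  let e : Arrow.mk Φ ≅ Arrow.mk (biproduct.map fun k => ((E k).arrow F).hom) :=
    Arrow.isoMk hL.iso hR.iso (hL.iso_hom_comp_map hR h)
  have he : ∀ t, (fun x => e.hom.left.app t x) '' G.set t =
      ⋃ k, (fun x => (biproduct.ι (fun k => ((E k).arrow F).left) k).app t x) ''
        (E k).sourceBasis F t := fun t => by
    simp only [← Elementary.sourceGenerators_set]
    exact hL.image_generators_set _ t
  have he' : ∀ t, (fun x => e.hom.right.app t x) '' H.set t =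
      ⋃ k, (fun x => (biproduct.ι (fun k => ((E k).arrow F).right) k).app t x) ''
        (E k).targetBasis F t := fun t => by
    simp only [← Elementary.targetGenerators_set]
    exact hR.image_generators_set _ t
  refine ⟨B, C, G, H, ⟨n, E, e, fun t => ?_, fun t => ?_⟩, hB, hC⟩
  · rw [hB]; exact he t
  · rw [hC]; exact he' t

end Standard

namespace QSplitting

variable {F : Type u} [Field F] {l : ℕ} {V : PersMod F l} {q : ℝ} (S : QSplitting V q)

/-- The projection `V ⟶ V_{<q}`. -/
def prFine : V ⟶ S.fine := S.iso.hom ≫ biprod.snd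

theorem incl_pr : S.incl ≫ S.pr = 𝟙 _ := by simp [incl, pr]

theorem inclFine_prFine : S.inclFine ≫ S.prFine = 𝟙 _ := by simp [inclFine, prFine]

theorem incl_prFine : S.incl ≫ S.prFine = 0 := by simp [incl, prFine]

theorem inclFine_pr : S.inclFine ≫ S.pr = 0 := by simp [inclFine, pr]

theorem total : S.pr ≫ S.incl + S.prFine ≫ S.inclFine = 𝟙 V := by
  have : S.pr ≫ S.incl + S.prFine ≫ S.inclFine =
      S.iso.hom ≫ (biprod.fst ≫ biprod.inl + biprod.snd ≫ biprod.inr) ≫ S.iso.inv := by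
    simp only [incl, pr, inclFine, prFine, Preadditive.add_comp, Preadditive.comp_add,
      Category.assoc]
  rw [this, biprod.total, Category.id_comp, S.iso.hom_inv_id]

theorem total_apply (t : Fin (l + 1)) (x : V.obj t) :
    S.incl.app t (S.pr.app t x) + S.inclFine.app t (S.prFine.app t x) = x := by
  have := congrArg (fun f : V ⟶ V => f.app t x) S.total
  exact this

/-- The generators of `V` formed by generators of `V_{≥q}` and `V_{<q}`. -/
def generators {κ κ' : Type*} [Fintype κ] [Fintype κ'] (G : Generators S.coarse κ)
    (H : Generators S.fine κ') : Generators V (κ ⊕ κ') where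
  alive k t := k.elim (fun k => G.alive k t) (fun k => H.alive k t)
  birth k := k.elim G.birth H.birth
  gen k t := k.elim (fun k => S.incl.app t (G.gen k t)) (fun k => S.inclFine.app t (H.gen k t))
  coord k t := k.elim (fun k => G.coord k t ∘ₗ (S.pr.app t).hom)
    (fun k => H.coord k t ∘ₗ (S.prFine.app t).hom)
  birth_le {k t} h := by
    rcases k with k | k
    · exact G.birth_le h
    · exact H.birth_le h
  alive_of_le {k t t'} h := by
    rcases k with k | k
    · exact G.alive_of_le h
    · exact H.alive_of_le h
  gen_eq_zero {k t} h := by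
    rcases k with k | k
    · change S.incl.app t (G.gen k t) = 0
      rw [G.gen_eq_zero h, map_zero]
    · change S.inclFine.app t (H.gen k t) = 0
      rw [H.gen_eq_zero h, map_zero]
  coord_self {k t} h := by
    rcases k with k | k
    · change G.coord k t (S.pr.app t (S.incl.app t _)) = 1
      rw [← app_comp_apply, S.incl_pr]
      exact G.coord_self h
    · change H.coord k t (S.prFine.app t (S.inclFine.app t _)) = 1
      rw [← app_comp_apply, S.inclFine_prFine]
      exact H.coord_self h
  coord_ne {j k} h t := by
    rcases j with j | j <;> rcases k with k | k
    · change G.coord j t (S.pr.app t (S.incl.app t _)) = 0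
      rw [← app_comp_apply, S.incl_pr]
      exact G.coord_ne (fun h' => h (congrArg _ h')) t
    · change G.coord j t (S.pr.app t (S.inclFine.app t _)) = 0
      rw [← app_comp_apply, S.inclFine_pr, app_zero_apply, map_zero]
    · change H.coord j t (S.prFine.app t (S.incl.app t _)) = 0
      rw [← app_comp_apply, S.incl_prFine, app_zero_apply, map_zero]
    · change H.coord j t (S.prFine.app t (S.inclFine.app t _)) = 0
      rw [← app_comp_apply, S.inclFine_prFine]
      exact H.coord_ne (fun h' => h (congrArg _ h')) t
  sum_coord t x := by
    rw [Fintype.sum_sum_type]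
    conv_rhs => rw [← S.total_apply t x, ← G.sum_coord t (S.pr.app t x),
      ← H.sum_coord t (S.prFine.app t x), map_sum, map_sum]
    congr 1
    · exact Finset.sum_congr rfl fun k _ => (map_smul _ _ _).symm
    · exact Finset.sum_congr rfl fun k _ => (map_smul _ _ _).symm
  map_gen {k t t'} f h := by
    rcases k with k | k
    · change V.map f (S.incl.app t (G.gen k t)) = S.incl.app t' (G.gen k t')
      rw [← app_map_apply, G.map_gen f h]
    · change V.map f (S.inclFine.app t (H.gen k t)) = S.inclFine.app t' (H.gen k t')
      rw [← app_map_apply, H.map_gen f h]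

theorem finiteDimensional_fine (hV : ∀ t, FiniteDimensional F (V.obj t)) (t : Fin (l + 1)) :
    FiniteDimensional F (S.fine.obj t) := finiteDimensional_of_retract hV S.inclFine_prFine t

theorem extends_of_generators (hV : ∀ t, FiniteDimensional F (V.obj t)) {κ : Type*} [Fintype κ]
    {B : BarcodeBasis S.coarse} {G : Generators S.coarse κ}
    (hB : ∀ t, Set.range (B.basis t) = G.set t) : S.Extends B := by
  obtain ⟨n, J, i, p, h⟩ := exists_interval_splitting S.fine (S.finiteDimensional_fine hV)
  let H := h.generators fun k => intervalGenerators (J k)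
  obtain ⟨B', hB'⟩ := H.exists_barcodeBasis
  obtain ⟨D, hD⟩ := (S.generators G H).exists_barcodeBasis
  refine ⟨B', D, fun t => ?_⟩
  rw [hD, hB, hB']
  ext x
  constructor
  · rintro ⟨k | k, hk, rfl⟩
    · exact Or.inl ⟨_, ⟨k, hk, rfl⟩, rfl⟩
    · exact Or.inr ⟨_, ⟨k, hk, rfl⟩, rfl⟩
  · rintro (⟨_, ⟨k, hk, rfl⟩, rfl⟩ | ⟨_, ⟨k, hk, rfl⟩, rfl⟩)
    · exact ⟨.inl k, hk, rfl⟩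
    · exact ⟨.inr k, hk, rfl⟩

/-- The fine part of a `q`-splitting disappears after a shift by `⌈q⌉`. -/
theorem map_incl_pr (hV : ∀ t, FiniteDimensional F (V.obj t)) {t u : Fin (l + 1)}
    (hu : (u : ℕ) = t + ⌈q⌉₊) (f : t ⟶ u) (x : V.obj t) :
    V.map f (S.incl.app t (S.pr.app t x)) = V.map f x := by
  obtain ⟨n, J, i, p, h⟩ := exists_interval_splitting S.fine (S.finiteDimensional_fine hV)
  have hz : ∀ y : S.fine.obj t, S.fine.map f y = 0 := by
    intro y
    rw [← h.sum_apply u (S.fine.map f y)]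
    refine Finset.sum_eq_zero fun k _ => ?_
    have h1 : (p k).app u (S.fine.map f y) = 0 := by
      apply intervalCoord_injective
      rw [app_map_apply, intervalCoord_map, map_zero]
      split_ifs with hk
      · refine intervalCoord_of_not_has (fun hk' => ?_) _
        have h2 := S.length_lt _ (h.mem_bars k)
        rw [Bar.length] at h2
        have h3 : ((J k).birth : ℕ) ≤ t := hk'.1
        have h4 : (u : ℕ) ≤ (J k).death := hk.2
        have h5 := Nat.le_ceil q
        have h6 : ((J k).birth : ℝ) + ⌈q⌉₊ ≤ (J k).death := by
          exact_mod_cast (by omega : ((J k).birth : ℕ) + ⌈q⌉₊ ≤ (J k).death)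
        linarith
      · rfl
    rw [h1, map_zero]
  conv_rhs => rw [← S.total_apply t x, map_add, ← app_map_apply S.inclFine, hz, map_zero, add_zero]

end QSplitting

section Main

variable {F : Type u} [Field F] {l : ℕ}

/-- Truncating the source and the target of an invertible morphism gives an almost invertible
morphism. -/
theorem AlmostInverse.truncate {V W V' W' : PersMod F l} {Φ : V ⟶ W} {s m : ℕ}
    {Ψ : ShiftHom W V s} (h : AlmostInverse Φ Ψ 0) {iV : V' ⟶ V} {pV : V ⟶ V'} {iW : W' ⟶ W}
    {pW : W ⟶ W'} (hV : iV ≫ pV = 𝟙 _) (hW : iW ≫ pW = 𝟙 _)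
    (hV' : ∀ (t u : Fin (l + 1)) (_ : (u : ℕ) = t + m) (f : t ⟶ u) (x : V.obj t),
      V.map f (iV.app t (pV.app t x)) = V.map f x)
    (hW' : ∀ (t u : Fin (l + 1)) (_ : (u : ℕ) = t + m) (f : t ⟶ u) (x : W.obj t),
      W.map f (iW.app t (pW.app t x)) = W.map f x) :
    AlmostInverse (iV ≫ Φ ≫ pW) (Ψ.restrict iW pV) m where
  left t u u' hu hm f g x := by
    change V'.map f (pV.app u (Ψ.app t u hu (iW.app t (pW.app t (Φ.app t (iV.app t x)))))) = _
    have htv : t.val + m < l + 1 := by omega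
    let v : Fin (l + 1) := ⟨t + m, htv⟩
    have htv' : t ≤ v := by change (t : ℕ) ≤ t + m; omega
    have hvu : v ≤ u' := by change (t : ℕ) + m ≤ u'; omega
    have huv : (u' : ℕ) = v + s := by change (u' : ℕ) = t + m + s; omega
    rw [← app_map_apply, ← Ψ.naturality_apply hu huv (homOfLE htv'), hW' t v rfl,
      ← app_map_apply, ← map_self_apply V (𝟙 u') (Ψ.app v u' huv _),
      h.left v u' u' huv rfl (𝟙 u') (homOfLE hvu), map_map_apply V _ _ g, app_map_apply,
      ← app_comp_apply, hV]
    rfl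
  right t u u' hu hm f g x := by
    change W'.map f (pW.app u (Φ.app u (iV.app u (pV.app u (Ψ.app t u hu (iW.app t x)))))) = _
    have htu : t ≤ u := by change (t : ℕ) ≤ u; omega
    rw [← app_map_apply, ← app_map_apply, hV' u u' hm, app_map_apply,
      ← map_self_apply W (𝟙 u) (Φ.app u _), h.right t u u hu rfl (𝟙 u) (homOfLE htu),
      map_map_apply W _ _ g, app_map_apply, ← app_comp_apply, hW]
    rfl

theorem IsInvertible.exists_almostInverse {V W : PersMod F l} {Φ : V ⟶ W} {δ : ℝ}
    (h : IsInvertible Φ δ) :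
    ∃ s : ℕ, (s : ℝ) = 2 * δ ∧ ∃ Ψ : ShiftHom W V s, AlmostInverse Φ Ψ 0 := by
  obtain ⟨s, hs, Ψ, h1, h2⟩ := h
  refine ⟨s, hs, Ψ, ⟨fun t u u' hu hm f g x => ?_, fun t u u' hu hm f g x => ?_⟩⟩
  · obtain rfl : u' = u := Fin.ext hm
    rw [map_self_apply]
    exact congrArg (fun k : V.obj t ⟶ V.obj u' => k x) (h1 t u' hu g)
  · obtain rfl : u' = u := Fin.ext hm
    rw [map_self_apply]
    exact congrArg (fun k : W.obj t ⟶ W.obj u' => k x) (h2 t u' hu g)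

/-- The shift of a shifted morphism by `m` further steps. -/
def ShiftHom.shift {V W : PersMod F l} {s : ℕ} (Ψ : ShiftHom W V s) (m : ℕ) :
    ShiftHom W V (s + m) where
  app t u hu := Ψ.app t ⟨t + s, by omega⟩ rfl ≫
    V.map (homOfLE (by change (t : ℕ) + s ≤ u; omega))
  naturality t t' u u' hu hu' f g := by
    have hf : (t : ℕ) ≤ t' := leOfHom f
    have h := Ψ.naturality t t' ⟨t + s, by omega⟩ ⟨t' + s, by omega⟩ rfl rfl f
      (homOfLE (by change (t : ℕ) + s ≤ t' + s; omega))
    rw [reassoc_of% h, Category.assoc, ← V.map_comp, ← V.map_comp]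
    rfl

theorem AlmostInverse.isInvertible {V W : PersMod F l} {Φ : V ⟶ W} {s m : ℕ}
    {Ψ : ShiftHom W V s} (h : AlmostInverse Φ Ψ m) {δ : ℝ} (hδ : ((s + m : ℕ) : ℝ) = 2 * δ) :
    IsInvertible Φ δ := by
  refine ⟨s + m, hδ, Ψ.shift m, fun t u hu f => ?_, fun t u hu f => ?_⟩
  · ext x
    exact h.left t _ u rfl (by change (u : ℕ) = t + s + m; omega) _ f x
  · ext x
    refine Eq.trans ?_ (h.right t ⟨t + s, by omega⟩ u rfl (by change (u : ℕ) = t + s + m; omega)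
      (homOfLE (by change (t : ℕ) + s ≤ u; omega)) f x)
    exact app_map_apply Φ _ _

/-- Strictly nested bars are far apart if the nestedness is large. -/
theorem far_of_lt_nestedness {V : PersMod F l} {s : ℕ} {δ q : ℝ} (hs : (s : ℝ) = 2 * δ)
    (h : (δ : EReal) < ((1 / 2 : ℝ) : EReal) * nestedness V - ((q / 2 : ℝ) : EReal))
    (hq : 0 ≤ q) : ∀ J ∈ bars V, ∀ K ∈ bars V, J.StrictlyNested K → J.Far s ⌈q⌉₊ K := by
  intro J hJ K hK hJK
  set r : ℝ := min |((J.birth : ℕ) : ℝ) - ((K.birth : ℕ) : ℝ)|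
    |((J.death : ℕ) : ℝ) - ((K.death : ℕ) : ℝ)| with hr
  have h1 : nestedness V ≤ (r : EReal) := iInf₂_le_of_le J hJ (iInf₂_le_of_le K hK (iInf_le _ hJK))
  have h2 : ((1 / 2 : ℝ) : EReal) * nestedness V ≤ ((1 / 2 : ℝ) : EReal) * (r : EReal) :=
    mul_le_mul_of_nonneg_left h1 (by exact_mod_cast (by norm_num : (0 : ℝ) ≤ 1 / 2))
  have h3 : (δ : EReal) < ((1 / 2 * r - q / 2 : ℝ) : EReal) := by
    refine h.trans_le ?_
    rw [EReal.coe_sub, EReal.coe_mul]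
    exact EReal.sub_le_sub h2 le_rfl
  have h4 : δ < 1 / 2 * r - q / 2 := EReal.coe_lt_coe_iff.1 h3
  have h5 : (s : ℝ) + q < r := by linarith
  have hb : ((K.birth : ℕ) : ℝ) < ((J.birth : ℕ) : ℝ) := Nat.cast_lt.2 hJK.1
  have hd : ((J.death : ℕ) : ℝ) < ((K.death : ℕ) : ℝ) := Nat.cast_lt.2 hJK.2
  have key : ∀ a b : ℕ, (s : ℝ) + q < (b : ℝ) - a → a + s < b ∧ a + s + ⌈q⌉₊ ≤ b := by
    intro a b hab
    have h6 : a + s < b := by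
      have : (a : ℝ) + s < b := by linarith
      exact_mod_cast this
    refine ⟨h6, ?_⟩
    have h7 : ⌈q⌉₊ ≤ b - (a + s) := by
      rw [Nat.ceil_le, Nat.cast_sub h6.le]
      push_cast
      linarith
    omega
  obtain ⟨k1, k2⟩ := key K.birth J.birth (by
    refine h5.trans_le ((min_le_left _ _).trans_eq (abs_of_pos (by linarith))))
  obtain ⟨k3, k4⟩ := key J.death K.death (by
    refine h5.trans_le ((min_le_right _ _).trans_eq ?_)
    rw [abs_sub_comm, abs_of_pos (by linarith)])
  exact ⟨k1, k2, k3, k4⟩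

/-- The truncation of an invertible morphism to retracts containing the long bars is invertible
and decomposes as a ladder persistence module. -/
theorem isInvertible_and_exists_decomposesIn {V W V' W' : PersMod F l}
    (hV : ∀ t, FiniteDimensional F (V.obj t)) (hW : ∀ t, FiniteDimensional F (W.obj t))
    {Φ : V ⟶ W} {δ q : ℝ} (hΦ : IsInvertible Φ δ) (hq : 0 ≤ q)
    {iV : V' ⟶ V} {pV : V ⟶ V'} {iW : W' ⟶ W}
    {pW : W ⟶ W'} (hiV : iV ≫ pV = 𝟙 _) (hiW : iW ≫ pW = 𝟙 _)
    (hV' : ∀ (t u : Fin (l + 1)) (_ : (u : ℕ) = t + ⌈q⌉₊) (f : t ⟶ u) (x : V.obj t),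
      V.map f (iV.app t (pV.app t x)) = V.map f x)
    (hW' : ∀ (t u : Fin (l + 1)) (_ : (u : ℕ) = t + ⌈q⌉₊) (f : t ⟶ u) (x : W.obj t),
      W.map f (iW.app t (pW.app t x)) = W.map f x)
    (hδ : (δ : EReal) < ((1 / 2 : ℝ) : EReal) * min (nestedness V') (nestedness W') -
      ((q / 2 : ℝ) : EReal)) :
    IsInvertible (iV ≫ Φ ≫ pW) (δ + ⌈q⌉₊ / 2) ∧
      ∃ (B : BarcodeBasis V') (C : BarcodeBasis W') (n : ℕ) (G : Generators V' (Fin n))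
        (H : Generators W' (Fin n)), DecomposesIn (iV ≫ Φ ≫ pW) B C ∧
        (∀ t, Set.range (B.basis t) = G.set t) ∧ ∀ t, Set.range (C.basis t) = H.set t := by
  obtain ⟨s, hs, Ψ, hΨ⟩ := hΦ.exists_almostInverse
  have hΨ' := hΨ.truncate hiV hiW hV' hW'
  have hmono : ∀ x : EReal, min (nestedness V') (nestedness W') ≤ x →
      (δ : EReal) < ((1 / 2 : ℝ) : EReal) * x - ((q / 2 : ℝ) : EReal) := fun x hx =>
    hδ.trans_le (EReal.sub_le_sub (mul_le_mul_of_nonneg_left hx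
      (by exact_mod_cast (by norm_num : (0 : ℝ) ≤ 1 / 2))) le_rfl)
  refine ⟨hΨ'.isInvertible (by push_cast; linarith), ?_⟩
  obtain ⟨n, E, iL, pL, iR, pR, hL, hR, hE⟩ := exists_elementary_splitting
    (finiteDimensional_of_retract hV hiV) (finiteDimensional_of_retract hW hiW) hΨ'
    (far_of_lt_nestedness hs (hmono _ (min_le_left _ _)) hq)
    (far_of_lt_nestedness hs (hmono _ (min_le_right _ _)) hq)
  obtain ⟨B, C, G, H, h⟩ := exists_decomposesIn hL hR hE
  exact ⟨B, C, n, G, H, h⟩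

end Main

end Ladder

end

theorem mainTheorem2 {F : Type*} [Field F] {l : ℕ} (V W : Ladder.PersMod F l)
    (hV : ∀ i, FiniteDimensional F (V.obj i)) (hW : ∀ i, FiniteDimensional F (W.obj i))
    (Φ : V ⟶ W) (δ : ℝ) (hΦ : Ladder.IsInvertible Φ δ) (q : ℝ) (hq : 0 ≤ q) :
    (∀ SW : Ladder.QSplitting W q,
      (δ : EReal) < ((1 / 2 : ℝ) : EReal) *
          min (Ladder.nestedness V) (Ladder.nestedness SW.coarse) - ((q / 2 : ℝ) : EReal) →
        Ladder.IsInvertible (Φ ≫ SW.pr) (δ + ⌈q⌉₊ / 2) ∧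
        ∃ (B : Ladder.BarcodeBasis V) (C : Ladder.BarcodeBasis SW.coarse),
          Ladder.DecomposesIn (Φ ≫ SW.pr) B C ∧ SW.Extends C) ∧
    (∀ SV : Ladder.QSplitting V q,
      (δ : EReal) < ((1 / 2 : ℝ) : EReal) *
          min (Ladder.nestedness SV.coarse) (Ladder.nestedness W) - ((q / 2 : ℝ) : EReal) →
        Ladder.IsInvertible (SV.incl ≫ Φ) (δ + ⌈q⌉₊ / 2) ∧
        ∃ (B : Ladder.BarcodeBasis SV.coarse) (C : Ladder.BarcodeBasis W),
          Ladder.DecomposesIn (SV.incl ≫ Φ) B C ∧ SV.Extends B) ∧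
    (∀ (SV : Ladder.QSplitting V q) (SW : Ladder.QSplitting W q),
      (δ : EReal) < ((1 / 2 : ℝ) : EReal) *
          min (Ladder.nestedness SV.coarse) (Ladder.nestedness SW.coarse) -
            ((q / 2 : ℝ) : EReal) →
        Ladder.IsInvertible (SV.incl ≫ Φ ≫ SW.pr) (δ + ⌈q⌉₊ / 2) ∧
        ∃ (B : Ladder.BarcodeBasis SV.coarse) (C : Ladder.BarcodeBasis SW.coarse),
          Ladder.DecomposesIn (SV.incl ≫ Φ ≫ SW.pr) B C ∧ SV.Extends B ∧ SW.Extends C) := by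
  refine ⟨fun SW hδ => ?_, fun SV hδ => ?_, fun SV SW hδ => ?_⟩
  · obtain ⟨h1, B, C, n, G, H, h2, -, hC⟩ := Ladder.isInvertible_and_exists_decomposesIn hV hW hΦ hq
      (Category.comp_id (𝟙 V)) SW.incl_pr (fun _ _ _ _ _ => rfl)
      (fun _ _ hu f x => SW.map_incl_pr hW hu f x) hδ
    rw [Category.id_comp] at h1 h2
    exact ⟨h1, B, C, h2, SW.extends_of_generators hW hC⟩
  · obtain ⟨h1, B, C, n, G, H, h2, hB, -⟩ := Ladder.isInvertible_and_exists_decomposesIn hV hW hΦ hq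
      SV.incl_pr (Category.comp_id (𝟙 W)) (fun _ _ hu f x => SV.map_incl_pr hV hu f x)
      (fun _ _ _ _ _ => rfl) hδ
    rw [Category.comp_id] at h1 h2
    exact ⟨h1, B, C, h2, SV.extends_of_generators hV hB⟩
  · obtain ⟨h1, B, C, n, G, H, h2, hB, hC⟩ :=
      Ladder.isInvertible_and_exists_decomposesIn hV hW hΦ hq SV.incl_pr SW.incl_pr
        (fun _ _ hu f x => SV.map_incl_pr hV hu f x) (fun _ _ hu f x => SW.map_incl_pr hW hu f x) hδ
    exact ⟨h1, B, C, h2, SV.extends_of_generators hV hB, SW.extends_of_generators hW hC⟩
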